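/- For a finite graded poset $P$ of rank $n+1$ (with least and greatest elements) and $S\subseteq[n]=\{1,\dots,n\}$, let $f_S$ be the number of chains in $P$ whose elements lie exactly on the ranks in $S$, let $h_S=\sum_{T\subseteq S}(-1)^{|S\setminus T|}f_T$, and let $u_S=u_1u_2\cdots u_n$ be the word with $u_i=\mathbf b$ if $i\in S$ and $u_i=\mathbf a$ if $i\notin S$. The $\mathbf{ab}$-index of $P$ is $\sum_{S\subseteq[n]}h_S\,u_S\in\mathbb Q\langle\mathbf a,\mathbf b\rangle$. If it can be written as a polynomial in the non-commuting variables $\mathbf c=\mathbf a+\mathbf b$ and $\mathbf d=\mathbf a\mathbf b+\mathbf b\mathbf a$, as is the case for the Boolean lattice $B_{n+1}$ of all subsets of $[n+1]$ ordered by inclusion, this (unique) polynomial is called the $\mathbf{cd}$-index $\Psi(P)$. Give $\mathbf c$ degree $1$ and $\mathbf d$ degree $2$. For a $\mathbf{cd}$-monomial $v$ of degree $n$, let $\beta(v)$ be the coefficient of $v$ in $\Psi(B_{n+1})$. For a non-empty list $(m_1,\dots,m_k)$ of non-negative integers put $$\beta(m_1,\dots,m_k)=\beta(\mathbf c^{m_1}\mathbf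 d\,\mathbf c^{m_2}\mathbf d\cdots\mathbf d\,\mathbf c^{m_k}).$$ In expressions such as $\beta(M,m,n,N)$ the lists and entries are concatenated. For non-negative integers $m_1,n_1,m_2,n_2$ with $m_1+n_1=m_2+n_2$, the pair $(m_1,n_1)$ is called strictly better balanced than the pair $(m_2,n_2)$ if $|m_1-n_1|<|m_2-n_2|$. Theorem. Let $M$ and $N$ be any two (possibly empty) lists of non-negative integers, let $m,n$ be non-negative integers with $n>m$, and let $(m_1,n_1)$ be strictly better balanced than $(m_2,n_2)$. Then (1) $\beta(M,m,n)\ge\beta(M,n,m)$, with equality if $M$ is empty; (2) $\beta(M,m_1,n_1,N)>\beta(M,m_2,n_2,N)$. -/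

import Mathlib

namespace CDIndex

noncomputable section

/-- The letters of **ab**-words. -/
inductive AB : Type
  | a
  | b

/-- The letters of **cd**-words. -/
inductive CD : Type
  | c
  | d

/-- Polynomials with rational coefficients in non-commuting variables `X`: finite linear
combinations of words in the alphabet `X`, multiplied by concatenation. -/
abbrev NCPoly (X : Type) : Type := MonoidAlgebra ℚ (FreeMonoid X)

/-- The monomial given by a word, as a polynomial. -/
def monom {X : Type} (w : FreeMonoid X) : NCPoly X := MonoidAlgebra.single w 1

/-- Coefficient of the word `w` in the polynomial `p`. -/
def coefficient {X : Type} (p : NCPoly X) (w : FreeMonoid X) : ℚ := p.coeff w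

section Poset

variable (P : Type) [PartialOrder P] [BoundedOrder P] [Fintype P] [GradeMinOrder ℕ P]

/-- The flag `f`-vector of a finite graded poset: the number of chains
whose elements lie exactly on the ranks in `S`. -/
def flagF (S : Finset ℕ) : ℕ :=
  Nat.card {C : Finset P // IsChain (· ≤ ·) (C : Set P) ∧ grade ℕ '' (C : Set P) = (S : Set ℕ)}

/-- The flag `h`-vector, `h_S = ∑_{T ⊆ S} (-1)^{|S - T|} f_T`. -/
def flagH (S : Finset ℕ) : ℤ :=
  ∑ T ∈ S.powerset, (-1) ^ (S \ T).card * (flagF P T : ℤ)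

open Classical in
/-- The word `u_S = u_1 u_2 ⋯ u_n`, with `u_i = b` for `i ∈ S` and `u_i = a` for `i ∉ S`. -/
def abWord (n : ℕ) (S : Finset ℕ) : FreeMonoid AB :=
  FreeMonoid.ofList ((List.range n).map fun i => if i + 1 ∈ S then AB.b else AB.a)

/-- The **ab**-index of a finite graded poset of rank `n + 1`:
`∑_{S ⊆ {1, …, n}} h_S u_S`. The rank of `P` is the grade of its top element. -/
def abIndex : NCPoly AB :=
  ∑ S ∈ (Finset.Icc 1 (grade ℕ (⊤ : P) - 1)).powerset,
    (flagH P S : ℚ) • monom (abWord (grade ℕ (⊤ : P) - 1) S)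

/-- `c ↦ a + b` and `d ↦ ab + ba`. -/
def letterToAB : CD → NCPoly AB
  | CD.c => monom (FreeMonoid.of AB.a) + monom (FreeMonoid.of AB.b)
  | CD.d => monom (FreeMonoid.of AB.a * FreeMonoid.of AB.b) +
      monom (FreeMonoid.of AB.b * FreeMonoid.of AB.a)

/-- The substitution `c = a + b`, `d = ab + ba`, as a homomorphism `ℚ⟨c, d⟩ → ℚ⟨a, b⟩`. -/
def cdToAB : NCPoly CD →ₐ[ℚ] NCPoly AB :=
  MonoidAlgebra.lift ℚ (NCPoly AB) (FreeMonoid CD) (FreeMonoid.lift letterToAB)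

/-- `Φ` expresses the **ab**-index of `P` as a polynomial in `c = a + b` and `d = ab + ba`. -/
def IsCDIndex (Φ : NCPoly CD) : Prop := cdToAB Φ = abIndex P

open Classical in
/-- The **cd**-index of `P`: the polynomial in `c` and `d` which becomes the **ab**-index of `P`
under `c = a + b`, `d = ab + ba` (and `0` if there is no such polynomial). -/
def cdIndex : NCPoly CD :=
  if h : ∃ Φ : NCPoly CD, IsCDIndex P Φ then h.choose else 0

end Poset

/-- The Boolean lattice of rank `n`: all subsets of an `n`-element set, ordered by inclusion. -/
abbrev BooleanLattice (n : ℕ) : Type := Finset (Fin n)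

/-- The degree of a letter: `c` has degree `1` and `d` has degree `2`. -/
def letterDegree : CD → ℕ
  | CD.c => 1
  | CD.d => 2

/-- The degree of a **cd**-monomial. -/
def degree (v : FreeMonoid CD) : ℕ := ((FreeMonoid.toList v).map letterDegree).sum

/-- For a **cd**-monomial `v` of degree `n`,
the coefficient of `v` in the **cd**-index of the Boolean lattice of rank `n + 1`. -/
def betaMonomial (v : FreeMonoid CD) : ℚ :=
  coefficient (cdIndex (BooleanLattice (degree v + 1))) v

/-- The **cd**-monomial `c^{m₁} d c^{m₂} d ⋯ d c^{m_k}` of the non-empty list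
`(m₁, m₂, …, m_k)` with first entry `m₁` and remaining entries `L`. -/
def listMonomial (m₁ : ℕ) (L : List ℕ) : FreeMonoid CD :=
  FreeMonoid.of CD.c ^ m₁ *
    (L.map fun m => FreeMonoid.of CD.d * FreeMonoid.of CD.c ^ m).prod

/-- `β` of a list. The empty list stands for the formal symbol `e` of degree `-1`,
which is the **cd**-index of the Boolean lattice of rank `0`, so `β(e) = 1`. -/
def beta : List ℕ → ℚ
  | [] => 1
  | m₁ :: L => betaMonomial (listMonomial m₁ L)

/-- `(m₁, n₁)` is strictly better balanced than `(m₂, n₂)`. -/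
def StrictlyBetterBalanced (m₁ n₁ m₂ n₂ : ℕ) : Prop :=
  m₁ + n₁ = m₂ + n₂ ∧ |(m₁ : ℤ) - (n₁ : ℤ)| < |(m₂ : ℤ) - (n₂ : ℤ)|

end

end CDIndex

/-! Write g(v) for β(v)/(deg v + 1)!, called `gval` below. All words compared in the theorem have
the same degree, so inequalities for β are inequalities for g.

Identification of g. Forgetting whether a given position of an ab-word carries a or b makes the
Boolean flag h-vector multiplicative, up to a binomial coefficient. Dually, for the coproduct c ↦
2·1⊗1, d ↦ c⊗1 + 1⊗c, this says `cut gval u v = gval u * gval v` (`cut_gval`). Here g is defined by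
a symmetric quadratic recursion (`gval_rec`): remove a `c` at either end, or split the word at a
`d`. The cut relation follows by induction, and the flag h-vector then identifies g with the
normalized coefficients (`flagH_boolean`, `betaMonomial_eq`). A solution of the homogeneous cut
relation that vanishes on a power of `c` is zero (`eq_zero_of_cut`); this yields a second, one-sided
recursion (`gval_rec_left`).

Inequalities. The one-sided recursion and the cut relation give, for every word x, the quotient
bounds p + 2 ≤ g(x d c^p) / g(x d c^(p+1)) < p + 3 (`gval_append_d_c_succ_le`,
`lt_gval_append_d_c_succ`). If the pair ends the list, the one-sided recursion reduces both parts of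
the theorem to its terms split at the last two `d`s (`gval_two_swap_le`, `gval_two_lt`). A pair at
the beginning is handled by reversal. For a pair inside the list, the symmetric recursion leaves the
product g(x d c^m) g(c^n d y), which the quotient bounds control
(`mul_lt_mul_of_strictlyBetterBalanced`). -/

namespace CDIndex

noncomputable section

/-! ### Operations on cd-words: removing an end letter, splitting at `d` -/

/-- The degree of a word in `c` and `d`. -/
def wdeg : List CD → ℕ
  | [] => 0
  | x :: v => letterDegree x + wdeg v

@[simp] lemma wdeg_nil : wdeg [] = 0 := rfl
@[simp] lemma wdeg_c (v) : wdeg (CD.c :: v) = 1 + wdeg v := rfl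
@[simp] lemma wdeg_d (v) : wdeg (CD.d :: v) = 2 + wdeg v := rfl
@[simp] lemma wdeg_append (u v : List CD) : wdeg (u ++ v) = wdeg u + wdeg v := by
  induction u with
  | nil => simp
  | cons x u ih => simp [wdeg, ih, add_assoc]
@[simp] lemma wdeg_reverse (u : List CD) : wdeg u.reverse = wdeg u := by
  induction u with
  | nil => simp
  | cons x u ih => simp [wdeg, ih, add_comm]
@[simp] lemma wdeg_replicate_c (n : ℕ) : wdeg (List.replicate n CD.c) = n := by
  induction n with
  | zero => simp
  | succ n ih => simp [List.replicate_succ, ih, add_comm]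

/-- Removal of an initial letter `c`. -/
def firstC (K : List CD → ℚ) : List CD → ℚ
  | CD.c :: v => K v
  | _ => 0

/-- Removal of a final letter `c`. -/
def lastC (K : List CD → ℚ) (v : List CD) : ℚ :=
  firstC (fun u => K u.reverse) v.reverse

/-- The sum of `K u w` over all factorizations `v = u d w`. -/
def splitD : (List CD → List CD → ℚ) → List CD → ℚ
  | _, [] => 0
  | K, CD.c :: v => splitD (fun u w => K (CD.c :: u) w) v
  | K, CD.d :: v => K [] v + splitD (fun u w => K (CD.d :: u) w) v

@[simp] lemma firstC_nil (K) : firstC K [] = 0 := rfl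
@[simp] lemma firstC_c (K v) : firstC K (CD.c :: v) = K v := rfl
@[simp] lemma firstC_d (K v) : firstC K (CD.d :: v) = 0 := rfl
@[simp] lemma lastC_nil (K) : lastC K [] = 0 := rfl
@[simp] lemma lastC_c (K v) : lastC K (v ++ [CD.c]) = K v := by simp [lastC]
@[simp] lemma lastC_d (K v) : lastC K (v ++ [CD.d]) = 0 := by simp [lastC]
@[simp] lemma lastC_singleton_c (K) : lastC K [CD.c] = K [] := lastC_c K []
@[simp] lemma lastC_singleton_d (K) : lastC K [CD.d] = 0 := lastC_d K []
@[simp] lemma splitD_nil (K) : splitD K [] = 0 := rfl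
@[simp] lemma splitD_c (K v) :
    splitD K (CD.c :: v) = splitD (fun u w => K (CD.c :: u) w) v := rfl
@[simp] lemma splitD_d (K v) :
    splitD K (CD.d :: v) = K [] v + splitD (fun u w => K (CD.d :: u) w) v := rfl

lemma lastC_append (K) (u v : List CD) (hv : v ≠ []) :
    lastC K (u ++ v) = lastC (fun w => K (u ++ w)) v := by
  obtain ⟨w, x, rfl⟩ := List.eq_nil_or_concat' v |>.resolve_left hv
  rw [← List.append_assoc]
  cases x
  · rw [lastC_c, lastC_c]
  · rw [lastC_d, lastC_d]

lemma lastC_cons_d (K) (v : List CD) :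
    lastC K (CD.d :: v) = lastC (fun w => K (CD.d :: w)) v := by
  rcases List.eq_nil_or_concat' v with rfl | ⟨w, x, rfl⟩
  · simp
  · rw [← List.cons_append]
    cases x
    · rw [lastC_c, lastC_c]
    · rw [lastC_d, lastC_d]

lemma lastC_append_d (K) (u v : List CD) :
    lastC K (u ++ CD.d :: v) = lastC (fun w => K (u ++ CD.d :: w)) v := by
  rw [lastC_append _ _ _ (by simp), lastC_cons_d]

lemma firstC_append_d (K) (u v : List CD) :
    firstC K (u ++ CD.d :: v) = firstC (fun w => K (w ++ CD.d :: v)) u := by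
  rcases u with _ | ⟨_ | _, u⟩ <;> simp

lemma splitD_append (K) (x y : List CD) :
    splitD K (x ++ y) =
      splitD (fun u w => K u (w ++ y)) x + splitD (fun u w => K (x ++ u) w) y := by
  induction x generalizing K with
  | nil => simp
  | cons a x ih => cases a <;> simp [ih, add_assoc]

lemma splitD_replicate_c (K) (n : ℕ) : splitD K (List.replicate n CD.c) = 0 := by
  induction n generalizing K with
  | zero => simp
  | succ n ih => simp [List.replicate_succ, ih]

lemma splitD_congr {K K' : List CD → List CD → ℚ} {v : List CD}
    (h : ∀ u w, v = u ++ CD.d :: w → K u w = K' u w) : splitD K v = splitD K' v := by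
  induction v generalizing K K' with
  | nil => rfl
  | cons a v ih =>
    cases a
    · simp only [splitD_c]
      exact ih fun u w e => h _ _ (by simp [e])
    · simp only [splitD_d]
      rw [h [] v rfl, ih fun u w e => h _ _ (by simp [e])]

lemma splitD_mono {K K' : List CD → List CD → ℚ} {v : List CD}
    (h : ∀ u w, v = u ++ CD.d :: w → K u w ≤ K' u w) : splitD K v ≤ splitD K' v := by
  induction v generalizing K K' with
  | nil => simp
  | cons a v ih =>
    cases a
    · simp only [splitD_c]
      exact ih fun u w e => h _ _ (by simp [e])
    · simp only [splitD_d]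
      exact add_le_add (h [] v rfl) (ih fun u w e => h _ _ (by simp [e]))

lemma splitD_add (K K' : List CD → List CD → ℚ) (v : List CD) :
    splitD (fun u w => K u w + K' u w) v = splitD K v + splitD K' v := by
  induction v generalizing K K' with
  | nil => simp
  | cons a v ih => cases a <;> simp [ih]; ring

lemma splitD_mul_left (r : ℚ) (K : List CD → List CD → ℚ) (v : List CD) :
    splitD (fun u w => r * K u w) v = r * splitD K v := by
  induction v generalizing K with
  | nil => simp
  | cons a v ih => cases a <;> simp [ih]; ring

lemma splitD_zero (v : List CD) : splitD (fun _ _ => 0) v = 0 := by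
  simpa using splitD_mul_left 0 (fun _ _ => 0) v

lemma splitD_nonneg {K : List CD → List CD → ℚ} {v : List CD}
    (h : ∀ u w, v = u ++ CD.d :: w → 0 ≤ K u w) : 0 ≤ splitD K v := by
  rw [← splitD_zero v]; exact splitD_mono h

lemma firstC_congr {K K' : List CD → ℚ} {v : List CD}
    (h : ∀ w, v = CD.c :: w → K w = K' w) : firstC K v = firstC K' v := by
  rcases v with _ | ⟨_ | _, v⟩ <;> simp at *
  exact h

lemma firstC_mono {K K' : List CD → ℚ} {v : List CD}
    (h : ∀ w, v = CD.c :: w → K w ≤ K' w) : firstC K v ≤ firstC K' v := by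
  rcases v with _ | ⟨_ | _, v⟩ <;> simp at *
  exact h

lemma lastC_congr {K K' : List CD → ℚ} {v : List CD}
    (h : ∀ w, v = w ++ [CD.c] → K w = K' w) : lastC K v = lastC K' v := by
  rcases List.eq_nil_or_concat' v with rfl | ⟨w, x, rfl⟩
  · simp
  · cases x
    · simpa using h w rfl
    · simp

lemma lastC_mono {K K' : List CD → ℚ} {v : List CD}
    (h : ∀ w, v = w ++ [CD.c] → K w ≤ K' w) : lastC K v ≤ lastC K' v := by
  rcases List.eq_nil_or_concat' v with rfl | ⟨w, x, rfl⟩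
  · simp
  · cases x
    · simpa using h w rfl
    · simp

lemma firstC_mul_left (r : ℚ) (K : List CD → ℚ) (v : List CD) :
    firstC (fun w => r * K w) v = r * firstC K v := by
  rcases v with _ | ⟨_ | _, v⟩ <;> simp

lemma firstC_add (K K' : List CD → ℚ) (v : List CD) :
    firstC (fun w => K w + K' w) v = firstC K v + firstC K' v := by
  rcases v with _ | ⟨_ | _, v⟩ <;> simp

lemma lastC_mul_left (r : ℚ) (K : List CD → ℚ) (v : List CD) :
    lastC (fun w => r * K w) v = r * lastC K v :=
  firstC_mul_left r _ _

lemma lastC_add (K K' : List CD → ℚ) (v : List CD) :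
    lastC (fun w => K w + K' w) v = lastC K v + lastC K' v :=
  firstC_add _ _ _

lemma firstC_nonneg {K : List CD → ℚ} {v : List CD}
    (h : ∀ w, v = CD.c :: w → 0 ≤ K w) : 0 ≤ firstC K v := by
  rcases v with _ | ⟨_ | _, v⟩ <;> simp at *
  exact h

lemma lastC_nonneg {K : List CD → ℚ} {v : List CD}
    (h : ∀ w, v = w ++ [CD.c] → 0 ≤ K w) : 0 ≤ lastC K v := by
  rcases List.eq_nil_or_concat' v with rfl | ⟨w, x, rfl⟩
  · simp
  · cases x
    · simpa using h w rfl
    · simp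

lemma lastC_splitD (K : List CD → List CD → ℚ) (u : List CD) :
    lastC (fun u' => splitD K u') u = splitD (fun x y => lastC (fun y' => K x y') y) u := by
  rcases List.eq_nil_or_concat' u with rfl | ⟨w, a, rfl⟩
  · simp
  · rw [splitD_append]
    cases a
    · simp
    · simp [splitD_zero]

lemma firstC_splitD (K : List CD → List CD → ℚ) (v : List CD) :
    firstC (fun v' => splitD K v') v = splitD (fun x y => firstC (fun x' => K x' y) x) v := by
  rcases v with _ | ⟨_ | _, v⟩ <;> simp [splitD_zero]

/-! ### The normalized coefficients and the symmetric recursion -/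

/-- Approximations to `gval` that are exact on words of length at most the first argument. -/
def gvalAux : ℕ → List CD → ℚ
  | _, [] => 1
  | 0, _ => 0
  | k + 1, v =>
    (firstC (gvalAux k) v + lastC (gvalAux k) v +
      splitD (fun u w => gvalAux k u * gvalAux k w) v) / (2 * (wdeg v + 1))

/-- The coefficient of `v` in the **cd**-index of the Boolean lattice of rank `deg v + 1`,
divided by `(deg v + 1)!`. -/
def gval (v : List CD) : ℚ := gvalAux v.length v

lemma gvalAux_eq (k : ℕ) (v : List CD) (h : v.length ≤ k) : gvalAux k v = gval v := by
  induction k using Nat.strong_induction_on generalizing v with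
  | _ k ih =>
  rcases v with _ | ⟨a, v⟩
  · cases k <;> simp [gval, gvalAux]
  obtain ⟨k, rfl⟩ : ∃ j, k = j + 1 := ⟨k - 1, by simp at h; omega⟩
  have e : ∀ u : List CD, u.length ≤ v.length → gvalAux k u = gvalAux v.length u := by
    intro u hu
    simp at h
    rw [ih k (by omega) u (by omega), ih v.length (by omega) u hu]
  have hlen : (a :: v).length = v.length + 1 := rfl
  rw [gval, hlen, gvalAux, gvalAux]
  · congr 2
    · congr 1
      · exact firstC_congr fun w hw => e w (by simp at hw; simp [hw])
      · refine lastC_congr fun w hw => e w ?_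
        have := congrArg List.length hw
        simp at this; omega
    · refine splitD_congr fun u w hw => ?_
      have := congrArg List.length hw
      simp at this
      rw [e u (by omega), e w (by omega)]
  all_goals simp

@[simp] lemma gval_nil : gval [] = 1 := by simp [gval, gvalAux]

/-- The symmetric quadratic recursion. -/
lemma gval_rec (v : List CD) (hv : v ≠ []) :
    2 * ((wdeg v : ℚ) + 1) * gval v =
      firstC gval v + lastC gval v + splitD (fun u w => gval u * gval w) v := by
  rcases v with _ | ⟨a, v⟩
  · simp at hv
  have hlen : (a :: v).length = v.length + 1 := rfl
  have h0 : (2 * ((wdeg (a :: v) : ℚ) + 1)) ≠ 0 := by positivity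
  rw [gval, hlen, gvalAux, mul_div_cancel₀ _ h0]
  · congr 1
    · congr 1
      · exact firstC_congr fun w hw => gvalAux_eq _ _ (by simp at hw; simp [hw])
      · refine lastC_congr fun w hw => gvalAux_eq _ _ ?_
        have := congrArg List.length hw
        simp at this; omega
    · refine splitD_congr fun u w hw => ?_
      have := congrArg List.length hw
      simp at this
      rw [gvalAux_eq _ u (by omega), gvalAux_eq _ w (by omega)]
  · simp

lemma gval_nonneg (v : List CD) : 0 ≤ gval v := by
  induction h : v.length using Nat.strong_induction_on generalizing v with
  | _ n ih =>
  subst h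
  by_cases hv : v = []
  · simp [hv]
  have h := gval_rec v hv
  have hF : 0 ≤ firstC gval v := firstC_nonneg fun w e => ih _ (by simp [e]) w rfl
  have hL : 0 ≤ lastC gval v := lastC_nonneg fun w e => ih _ (by simp [e]) w rfl
  have hS : 0 ≤ splitD (fun u w => gval u * gval w) v := splitD_nonneg fun u w e =>
    mul_nonneg (ih _ (by simp [e]) u rfl) (ih _ (by simp [e]; omega) w rfl)
  by_contra hneg
  push Not at hneg
  have : 2 * ((wdeg v : ℚ) + 1) * gval v < 0 := mul_neg_of_pos_of_neg (by positivity) hneg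
  linarith

/-- The first letter always supplies a positive term of the recursion: a `c` can be removed, and at
a `d` the word can be split with empty left factor. -/
lemma gval_pos (v : List CD) : 0 < gval v := by
  induction h : v.length using Nat.strong_induction_on generalizing v with
  | _ n ih =>
  subst h
  rcases v with _ | ⟨a, v⟩
  · simp
  have h := gval_rec (a :: v) (by simp)
  have hF : 0 ≤ firstC gval (a :: v) := firstC_nonneg fun w e => gval_nonneg w
  have hL : 0 ≤ lastC gval (a :: v) := lastC_nonneg fun w e => gval_nonneg w
  have hS : 0 ≤ splitD (fun u w => gval u * gval w) (a :: v) := splitD_nonneg fun u w e =>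
    mul_nonneg (gval_nonneg u) (gval_nonneg w)
  have hv := ih v.length (by simp) v rfl
  have key : 0 < 2 * ((wdeg (a :: v) : ℚ) + 1) * gval (a :: v) := by
    cases a
    · simp only [firstC_c] at h
      linarith
    · have : 0 ≤ splitD (fun u w => gval (CD.d :: u) * gval w) v := splitD_nonneg fun u w e =>
        mul_nonneg (gval_nonneg _) (gval_nonneg w)
      simp only [splitD_d, gval_nil, one_mul] at h
      linarith
  exact pos_of_mul_pos_right key (by positivity)

lemma gval_replicate_c (n : ℕ) : gval (List.replicate n CD.c) = 1 / ((n + 1).factorial : ℚ) := by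
  induction n with
  | zero => simp
  | succ n ih =>
    have h := gval_rec (List.replicate (n + 1) CD.c) (by simp)
    rw [splitD_replicate_c, wdeg_replicate_c] at h
    nth_rewrite 3 [List.replicate_succ'] at h
    nth_rewrite 2 [List.replicate_succ] at h
    rw [firstC_c, lastC_c, ih] at h
    rw [Nat.factorial_succ]
    push_cast at h ⊢
    have : ((n + 1).factorial : ℚ) ≠ 0 := by positivity
    field_simp at h ⊢
    linarith

lemma splitD_reverse (K : List CD → List CD → ℚ) (v : List CD) :
    splitD K v.reverse = splitD (fun u w => K w.reverse u.reverse) v := by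
  induction v generalizing K with
  | nil => simp
  | cons a v ih =>
    rw [List.reverse_cons, splitD_append, ih]
    cases a <;> simp [add_comm]

/-- The recursion is invariant under reversal: the two end terms are exchanged, and so are the two
factors of each split. -/
lemma gval_reverse (v : List CD) : gval v.reverse = gval v := by
  induction h : v.length using Nat.strong_induction_on generalizing v with
  | _ n ih =>
  subst h
  by_cases hv : v = []
  · simp [hv]
  have h1 := gval_rec v hv
  have h2 := gval_rec v.reverse (by simpa using hv)
  have e1 : firstC gval v.reverse = lastC gval v := by
    rw [lastC]
    exact firstC_congr fun w hw => (ih _ (by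
      have := congrArg List.length hw; simp at this; omega) w rfl).symm
  have e2 : lastC gval v.reverse = firstC gval v := by
    rw [lastC, List.reverse_reverse]
    exact firstC_congr fun w hw => (ih _ (by
      have := congrArg List.length hw; simp at this; omega) w rfl)
  have e3 : splitD (fun u w => gval u * gval w) v.reverse =
      splitD (fun u w => gval u * gval w) v := by
    rw [splitD_reverse]
    refine splitD_congr fun u w hw => ?_
    have := congrArg List.length hw
    simp at this
    rw [ih _ (by omega) u rfl, ih _ (by omega) w rfl, mul_comm]
  rw [e1, e2, e3, wdeg_reverse] at h2
  have h0 : (2 * ((wdeg v : ℚ) + 1)) ≠ 0 := by positivity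
  exact mul_left_cancel₀ h0 (by linarith)

/-! ### The cut relation -/

/-- The transpose of the coproduct determined by `c ↦ 2 · 1 ⊗ 1` and `d ↦ c ⊗ 1 + 1 ⊗ c`. -/
def cut (z : List CD → ℚ) (u v : List CD) : ℚ :=
  2 * z (u ++ CD.c :: v) + lastC (fun u' => z (u' ++ CD.d :: v)) u +
    firstC (fun v' => z (u ++ CD.d :: v')) v

/-- Cutting at a later place does not interfere with the first letter. For empty `u` the cut hits
that letter itself, hence the separate value in `cut_firstC_nil`. -/
lemma cut_firstC (K : List CD → ℚ) (u v : List CD) (hu : u ≠ []) :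
    cut (firstC K) u v = firstC (fun u' => cut K u' v) u := by
  rcases u with _ | ⟨_ | _, u⟩
  · simp at hu
  · simp only [cut, List.cons_append, firstC_c]
    congr 2
    rcases List.eq_nil_or_concat' u with rfl | ⟨w, x, rfl⟩
    · simp
    · rw [← List.cons_append]
      cases x
      · rw [lastC_c, lastC_c]; simp
      · rw [lastC_d, lastC_d]
  · simp [cut, lastC_cons_d]
    rcases v with _ | ⟨_ | _, v⟩ <;> simp [lastC] <;> rcases u.reverse with _ | ⟨_ | _, w⟩ <;> simp

lemma cut_firstC_nil (K : List CD → ℚ) (v : List CD) : cut (firstC K) [] v = 2 * K v := by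
  rcases v with _ | ⟨_ | _, v⟩ <;> simp [cut]

lemma cut_lastC (K : List CD → ℚ) (u v : List CD) (hv : v ≠ []) :
    cut (lastC K) u v = lastC (fun v' => cut K u v') v := by
  obtain ⟨w, x, rfl⟩ := List.eq_nil_or_concat' v |>.resolve_left hv
  have h3 : ∀ (u) p (w : List CD), lastC K (u ++ p :: (w ++ [CD.c])) = K (u ++ p :: w) := by
    intro u p w; rw [← lastC_c K]; simp
  have h2 : ∀ (u) p (w : List CD), lastC K (u ++ p :: (w ++ [CD.d])) = 0 := by
    intro u p w; rw [← lastC_d K (u ++ p :: w)]; simp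
  cases x
  · simp only [cut, lastC_c, h3]
    congr 1
    rcases w with _ | ⟨_ | _, w⟩
    · simp
    · simp [h3]
    · simp
  · simp only [cut, lastC_d, h2]
    rcases w with _ | ⟨_ | _, w⟩
    · simp [lastC]; rcases u.reverse with _ | ⟨_ | _, w⟩ <;> simp
    · simp [lastC]; rcases u.reverse with _ | ⟨_ | _, w⟩ <;> simp
    · simp [lastC]; rcases u.reverse with _ | ⟨_ | _, w⟩ <;> simp

lemma cut_lastC_nil (K : List CD → ℚ) (u : List CD) : cut (lastC K) u [] = 2 * K u := by
  simp [cut]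
  simp [lastC]; rcases u.reverse with _ | ⟨_ | _, w⟩ <;> simp

/-- A Leibniz rule. The `d` at which the word is split lies inside `u` or inside `v`, or it is the
`d` created by the cut; the last possibility gives the two end terms. -/
lemma cut_splitD (K : List CD → List CD → ℚ) (u v : List CD) :
    cut (splitD K) u v =
      splitD (fun x y => cut (K x) y v) u + splitD (fun x y => cut (fun t => K t y) u x) v +
        lastC (fun u' => K u' v) u + firstC (fun v' => K u v') v := by
  simp only [cut, splitD_append, splitD_c, splitD_d, splitD_add, splitD_mul_left, lastC_add,
    firstC_add, ← lastC_splitD, ← firstC_splitD]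
  have e1 : lastC (fun u' => splitD (fun a b => K (u' ++ CD.d :: a) b) v) u =
      splitD (fun x y => lastC (fun u' => K (u' ++ CD.d :: x) y) u) v := by
    simp only [lastC]
    rcases u.reverse with _ | ⟨_ | _, w⟩ <;> simp [splitD_zero]
  have e2 : firstC (fun v' => splitD (fun a b => K a (b ++ CD.d :: v')) u) v =
      splitD (fun x y => firstC (fun v' => K x (y ++ CD.d :: v')) v) u := by
    rcases v with _ | ⟨_ | _, v⟩ <;> simp [splitD_zero]
  simp only [e1, e2, List.append_nil]
  ring

/-- Only words of a single degree enter a cut, so degree-dependent factors may be treated as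
constants there. -/
lemma cut_congr {z z' : List CD → ℚ} {u v : List CD}
    (h : ∀ w, wdeg w = wdeg u + wdeg v + 1 → z w = z' w) : cut z u v = cut z' u v := by
  simp only [cut]
  rw [h (u ++ CD.c :: v) (by simp; omega)]
  congr 1
  · congr 1
    exact lastC_congr fun w e => h _ (by subst e; simp; omega)
  · exact firstC_congr fun w e => h _ (by subst e; simp; omega)

lemma cut_add (z z' : List CD → ℚ) (u v : List CD) :
    cut (fun w => z w + z' w) u v = cut z u v + cut z' u v := by
  simp only [cut, lastC_add, firstC_add]; ring

lemma cut_mul_left (r : ℚ) (z : List CD → ℚ) (u v : List CD) :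
    cut (fun w => r * z w) u v = r * cut z u v := by
  simp only [cut, lastC_mul_left, firstC_mul_left]; ring

/-- The cut relation. -/
theorem cut_gval (u v : List CD) : cut gval u v = gval u * gval v := by
  induction h : u.length + v.length using Nat.strong_induction_on generalizing u v with
  | _ n ih =>
  subst h
  -- The recursion is cut on both sides. The resulting terms regroup, by induction, into the
  -- recursion for `u` times `gval v` (`hF`) and `gval u` times the recursion for `v` (`hL`); the
  -- end terms missing from each come from the new `d` in `cut_splitD`.
  have key : (2 * ((wdeg u : ℚ) + wdeg v + 2)) * cut gval u v =
      cut (firstC gval) u v + cut (lastC gval) u v +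
        cut (splitD fun u w => gval u * gval w) u v := by
    rw [← cut_add, ← cut_add, ← cut_mul_left]
    refine cut_congr fun w hw => ?_
    rw [← gval_rec w (by rintro rfl; simp at hw), hw]
    push_cast; ring
  have hF : cut (firstC gval) u v + splitD (fun x y => gval x * cut gval y v) u +
      lastC gval u * gval v = 2 * ((wdeg u : ℚ) + 1) * (gval u * gval v) := by
    by_cases hu : u = []
    · subst hu
      rw [cut_firstC_nil]; simp
    · rw [cut_firstC _ _ _ hu, ← mul_assoc, gval_rec u hu]
      have e1 : firstC (fun u' => cut gval u' v) u = gval v * firstC gval u := by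
        rw [← firstC_mul_left]
        refine firstC_congr fun w e => ?_
        rw [ih _ (by simp [e]) w v rfl, mul_comm]
      have e2 : splitD (fun x y => gval x * cut gval y v) u =
          gval v * splitD (fun x y => gval x * gval y) u := by
        rw [← splitD_mul_left]
        refine splitD_congr fun x y e => ?_
        rw [ih _ (by simp [e]; omega) y v rfl]; ring
      rw [e1, e2]; ring
  have hL : cut (lastC gval) u v + splitD (fun x y => gval y * cut gval u x) v +
      gval u * firstC gval v = 2 * ((wdeg v : ℚ) + 1) * (gval u * gval v) := by
    by_cases hv : v = []
    · subst hv
      rw [cut_lastC_nil]; simp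
    · rw [cut_lastC _ _ _ hv, mul_left_comm, gval_rec v hv]
      have e1 : lastC (fun v' => cut gval u v') v = gval u * lastC gval v := by
        rw [← lastC_mul_left]
        refine lastC_congr fun w e => ?_
        rw [ih _ (by simp [e]) u w rfl]
      have e2 : splitD (fun x y => gval y * cut gval u x) v =
          gval u * splitD (fun x y => gval x * gval y) v := by
        rw [← splitD_mul_left]
        refine splitD_congr fun x y e => ?_
        rw [ih _ (by simp [e]) u x rfl]; ring
      rw [e1, e2]; ring
  have hS : cut (splitD fun u w => gval u * gval w) u v =
      splitD (fun x y => gval x * cut gval y v) u + splitD (fun x y => gval y * cut gval u x) v +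
        lastC gval u * gval v + gval u * firstC gval v := by
    have e1 : ∀ x y, cut (fun t => gval t * gval y) u x = gval y * cut gval u x := fun x y => by
      rw [← cut_mul_left]; simp only [mul_comm]
    rw [cut_splitD, firstC_mul_left]
    simp only [cut_mul_left, e1, mul_comm _ (gval v), lastC_mul_left]
  have h0 : (2 * ((wdeg u : ℚ) + wdeg v + 2)) ≠ 0 := by positivity
  refine mul_left_cancel₀ h0 ?_
  linarith

/-! ### Passage to ab-words and uniqueness -/

/-- `1` if the letters differ and `0` otherwise. -/
def differ : AB → AB → ℚ
  | AB.a, AB.b => 1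
  | AB.b, AB.a => 1
  | _, _ => 0

/-- The coefficient of an **ab**-word in the image of `∑ z(v) v` under `c ↦ a + b`,
`d ↦ ab + ba`. -/
def abEval : (List CD → ℚ) → List AB → ℚ
  | z, [] => z []
  | z, [_] => z [CD.c]
  | z, x :: y :: w =>
    abEval (fun v => z (CD.c :: v)) (y :: w) + differ x y * abEval (fun v => z (CD.d :: v)) w

lemma abEval_cons_cons (z) (x y : AB) (w : List AB) : abEval z (x :: y :: w) =
    abEval (fun v => z (CD.c :: v)) (y :: w) +
      differ x y * abEval (fun v => z (CD.d :: v)) w := by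
  rw [abEval]

@[simp] lemma abEval_nil (z) : abEval z [] = z [] := by rw [abEval]
@[simp] lemma abEval_singleton (z) (x : AB) : abEval z [x] = z [CD.c] := by rw [abEval]

lemma abEval_congr {z z' : List CD → ℚ} {w : List AB}
    (h : ∀ v, wdeg v = w.length → z v = z' v) : abEval z w = abEval z' w := by
  induction z, w using abEval.induct generalizing z' with
  | case1 z => simpa using h [] rfl
  | case2 z x => simpa using h [CD.c] rfl
  | case3 z x y w ih1 ih2 =>
    rw [abEval_cons_cons, abEval_cons_cons, ih1 fun v hv => h _ ?_, ih2 fun v hv => h _ ?_]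
    · simp [hv]; omega
    · simp at hv; simp [hv]; omega

lemma abEval_add (z z' : List CD → ℚ) (w : List AB) :
    abEval (fun v => z v + z' v) w = abEval z w + abEval z' w := by
  induction z, w using abEval.induct generalizing z' with
  | case1 z => simp
  | case2 z x => simp
  | case3 z x y w ih1 ih2 =>
    rw [abEval_cons_cons, abEval_cons_cons, abEval_cons_cons, ih1, ih2]; ring

lemma abEval_mul_left (r : ℚ) (z : List CD → ℚ) (w : List AB) :
    abEval (fun v => r * z v) w = r * abEval z w := by
  induction z, w using abEval.induct with
  | case1 z => simp
  | case2 z x => simp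
  | case3 z x y w ih1 ih2 =>
    rw [abEval_cons_cons, abEval_cons_cons, ih1, ih2]; ring

lemma abEval_zero (w : List AB) : abEval (fun _ => 0) w = 0 := by
  simpa using abEval_mul_left 0 (fun _ => 0) w

lemma abEval_replicate_a (z : List CD → ℚ) (n : ℕ) :
    abEval z (List.replicate n AB.a) = z (List.replicate n CD.c) := by
  induction n using Nat.strong_induction_on generalizing z with
  | _ n ih =>
  rcases n with _ | _ | n
  · simp
  · simp
  · rw [List.replicate_succ, List.replicate_succ, abEval_cons_cons, ← List.replicate_succ,
      ih _ (by omega)]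
    simp [differ, List.replicate_succ]

/-- `abEval` is injective in each degree. -/
lemma eq_zero_of_abEval (v : List CD) (z : List CD → ℚ)
    (h : ∀ w : List AB, w.length = wdeg v → abEval z w = 0) : z v = 0 := by
  induction v generalizing z with
  | nil => simpa using h [] rfl
  | cons x v ih =>
    cases x
    · refine ih (fun v => z (CD.c :: v)) fun w hw => ?_
      rcases w with _ | ⟨x, w⟩
      · have := h [AB.a] (by simp [← hw])
        simpa using this
      -- Doubling the first letter kills the `d` contribution and isolates the words beginning with
      -- `c`.
      · have := h (x :: x :: w) (by simp [← hw]; omega)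
        rw [abEval_cons_cons] at this
        cases x <;> simpa [differ] using this
    · refine ih (fun v => z (CD.d :: v)) fun w hw => ?_
      -- These two words have the same `c` contribution; their difference isolates the words
      -- beginning with `d`.
      have h1 := h (AB.a :: AB.b :: w) (by simp [← hw]; omega)
      have h2 := h (AB.b :: AB.b :: w) (by simp [← hw]; omega)
      rw [abEval_cons_cons] at h1 h2
      simp [differ] at h1 h2
      linarith

lemma cut_c_cons (z : List CD → ℚ) (u v : List CD) (hu : u ≠ []) :
    cut z (CD.c :: u) v = cut (fun t => z (CD.c :: t)) u v := by
  simp only [cut, List.cons_append]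
  congr 2
  exact lastC_append _ [CD.c] _ hu

lemma cut_c (z : List CD → ℚ) (v : List CD) :
    cut z [CD.c] v = cut (fun t => z (CD.c :: t)) [] v + z (CD.d :: v) := by
  simp [cut]; ring

lemma cut_d_cons (z : List CD → ℚ) (u v : List CD) :
    cut z (CD.d :: u) v = cut (fun t => z (CD.d :: t)) u v := by
  simp only [cut, List.cons_append, lastC_cons_d]

lemma abEval_cut_nil (z : List CD → ℚ) (y : List AB) :
    abEval (fun v => cut z [] v) y = abEval z (AB.a :: y) + abEval z (AB.b :: y) := by
  rcases y with _ | ⟨y, w⟩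
  · simp [cut]; ring
  · rw [abEval_cons_cons, abEval_cons_cons]
    have e : differ AB.a y + differ AB.b y = 1 := by cases y <;> simp [differ]
    have : abEval (fun v => firstC (fun v' => z (CD.d :: v')) v) (y :: w) =
        abEval (fun v => z (CD.d :: v)) w := by
      rcases w with _ | ⟨x, w⟩
      · simp
      · rw [abEval_cons_cons]
        simp [abEval_zero]
    simp only [cut, List.nil_append, lastC_nil, add_zero]
    rw [abEval_add, abEval_mul_left, this]
    linear_combination (-abEval (fun v => z (CD.d :: v)) w) * e

/-- Under c = a + b, d = ab + ba the coproduct becomes the one that deletes a letter, a ↦ 1⊗1 and b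
↦ 1⊗1, since this sends ab + ba to c⊗1 + 1⊗c. Its transpose sums over the two letters at the deleted
place. -/
lemma abEval_cut (z : List CD → ℚ) (x y : List AB) :
    abEval (fun u => abEval (fun v => cut z u v) y) x =
      abEval z (x ++ AB.a :: y) + abEval z (x ++ AB.b :: y) := by
  induction z, x using abEval.induct with
  | case1 z => simpa using abEval_cut_nil z y
  | case2 z x =>
    simp only [abEval_singleton, cut_c, abEval_add, abEval_cut_nil]
    simp only [List.singleton_append]
    rw [abEval_cons_cons, abEval_cons_cons]
    have e : differ x AB.a + differ x AB.b = 1 := by cases x <;> simp [differ]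
    linear_combination (-abEval (fun v => z (CD.d :: v)) y) * e
  | case3 z x x' w ih1 ih2 =>
    simp only [List.cons_append] at ih1 ⊢
    rw [abEval_cons_cons, abEval_cons_cons z, abEval_cons_cons z]
    simp only [cut_d_cons, ih2]
    have : abEval (fun v => abEval (fun v_1 => cut z (CD.c :: v) v_1) y) (x' :: w) =
        abEval (fun v => abEval (fun v_1 => cut (fun t => z (CD.c :: t)) v v_1) y) (x' :: w) := by
      refine abEval_congr fun v hv => ?_
      have : v ≠ [] := by rintro rfl; simp at hv
      simp only [cut_c_cons _ _ _ this]
    rw [this, ih1]; ring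

/-- A function satisfying the homogeneous cut relation and vanishing on `cⁿ` is zero. -/
lemma eq_zero_of_cut (z : List CD → ℚ) (n : ℕ) (hc : z (List.replicate n CD.c) = 0)
    (hz : ∀ u v, wdeg u + wdeg v + 1 = n → cut z u v = 0) (v : List CD) (hv : wdeg v = n) :
    z v = 0 := by
  refine eq_zero_of_abEval v z fun w hw => ?_
  rw [hv] at hw
  -- Changing one letter only changes the sign, so every value is, up to sign, the value at the
  -- all-`a` word.
  have step : ∀ x y : List AB, x.length + y.length + 1 = n →
      abEval z (x ++ AB.b :: y) = - abEval z (x ++ AB.a :: y) := by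
    intro x y hxy
    have h := abEval_cut z x y
    have h0 : abEval (fun u => abEval (fun v => cut z u v) y) x = 0 := by
      rw [← abEval_zero x]
      refine abEval_congr fun u hu => ?_
      rw [← abEval_zero y]
      exact abEval_congr fun v hv => hz u v (by omega)
    linarith
  have main : ∀ (x : List AB) (k : ℕ), x.length + k = n →
      abEval z (List.replicate k AB.a ++ x) = 0 := by
    intro x
    induction x with
    | nil =>
      intro k hk
      simp at hk; subst hk
      simpa [abEval_replicate_a] using hc
    | cons s x ih =>
      intro k hk
      have e := ih (k + 1) (by simp at hk; omega)
      rw [List.replicate_succ', List.append_assoc, List.singleton_append] at e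
      cases s
      · exact e
      · rw [step _ _ (by simp at hk ⊢; omega), e, neg_zero]
  simpa using main w 0 (by simpa using hw)

/-! ### The one-sided recursion -/

/-- The one-sided quadratic recursion. -/
theorem gval_rec_left (v : List CD) :
    (wdeg v : ℚ) * (wdeg v + 1) * gval v =
      wdeg v * firstC gval v + splitD (fun u w => ((wdeg w : ℚ) + 1) * (gval u * gval w)) v := by
  induction h : wdeg v using Nat.strong_induction_on generalizing v with
  | _ n ih =>
  rw [eq_comm, ← sub_eq_zero]
  refine eq_zero_of_cut (fun v => (n : ℚ) * firstC gval v +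
    splitD (fun u w => ((wdeg w : ℚ) + 1) * (gval u * gval w)) v - n * (n + 1) * gval v)
    n ?_ ?_ v h
  · rcases n with _ | n
    · simp
    · simp only [splitD_replicate_c, gval_replicate_c]
      simp only [List.replicate_succ, firstC_c, gval_replicate_c]
      rw [Nat.factorial_succ (n + 1)]
      have : ((n + 1).factorial : ℚ) ≠ 0 := by positivity
      push_cast
      field_simp
      ring
  · clear h v
    intro u v huv
    have ihu := ih (wdeg u) (by omega) u rfl
    have ihv := ih (wdeg v) (by omega) v rfl
    have hn : (n : ℚ) = wdeg u + wdeg v + 1 := by rw [← huv]; push_cast; ring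
    -- The factor n = deg u + deg v + 1 of the cut of `firstC gval` is divided between `e1`, used
    -- deg v + 1 times, and `e1'`. The former absorbs, by the symmetric recursion for `u`, the
    -- unweighted terms arising in `e2`. In the latter the factor deg u removes the exceptional case
    -- of empty `u`. What remains is the induction hypothesis for `u` and for `v`.
    have e1 : cut (firstC gval) u v + lastC gval u * gval v +
        splitD (fun x y => gval x * gval y) u * gval v = 2 * (wdeg u + 1) * gval u * gval v := by
      by_cases hu : u = []
      · subst hu; simp [cut_firstC_nil]
      · rw [cut_firstC _ _ _ hu, gval_rec u hu]
        simp only [cut_gval, mul_comm _ (gval v), firstC_mul_left]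
        ring
    have e1' : (wdeg u : ℚ) * (cut (firstC gval) u v) = wdeg u * (firstC gval u * gval v) := by
      by_cases hu : u = []
      · subst hu; simp
      · rw [cut_firstC _ _ _ hu]
        simp only [cut_gval, mul_comm _ (gval v), firstC_mul_left]
    have e2 : cut (splitD (fun u w => ((wdeg w : ℚ) + 1) * (gval u * gval w))) u v =
        splitD (fun x y => ((wdeg y : ℚ) + 1) * (gval x * gval y)) u * gval v +
        (wdeg v + 1) * (splitD (fun x y => gval x * gval y) u * gval v) +
        gval u * splitD (fun x y => ((wdeg y : ℚ) + 1) * (gval x * gval y)) v +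
        (wdeg v + 1) * (lastC gval u * gval v) + wdeg v * (gval u * firstC gval v) := by
      rw [cut_splitD]
      have f1 : splitD (fun x y =>
          cut (fun t => ((wdeg t : ℚ) + 1) * (gval x * gval t)) y v) u =
          splitD (fun x y => ((wdeg y : ℚ) + 1) * (gval x * gval y)) u * gval v +
          (wdeg v + 1) * (splitD (fun x y => gval x * gval y) u * gval v) := by
        rw [mul_comm _ (gval v), ← splitD_mul_left, mul_comm _ (gval v), ← splitD_mul_left,
          ← splitD_mul_left, ← splitD_add]
        refine splitD_congr fun x y _ => ?_
        have : cut (fun t => ((wdeg t : ℚ) + 1) * (gval x * gval t)) y v =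
            (((wdeg y : ℚ) + wdeg v + 2) * gval x) * cut gval y v := by
          rw [← cut_mul_left]
          refine cut_congr fun t ht => ?_
          rw [ht]; push_cast; ring
        rw [this, cut_gval]; ring
      have f2 : splitD (fun x y =>
          cut (fun t => ((wdeg y : ℚ) + 1) * (gval t * gval y)) u x) v =
          gval u * splitD (fun x y => ((wdeg y : ℚ) + 1) * (gval x * gval y)) v := by
        rw [← splitD_mul_left]
        refine splitD_congr fun x y _ => ?_
        simp only [cut_mul_left, mul_comm _ (gval y), cut_gval]
        ring
      have f3 : firstC (fun v' => ((wdeg v' : ℚ) + 1) * (gval u * gval v')) v =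
          wdeg v * (gval u * firstC gval v) := by
        rw [← mul_assoc, ← firstC_mul_left]
        refine firstC_congr fun w e => ?_
        subst e; simp; ring
      rw [f1, f2, f3, lastC_mul_left]
      simp only [mul_comm _ (gval v), lastC_mul_left]
    simp only [sub_eq_add_neg, ← neg_mul, cut_add, cut_mul_left, cut_gval, e2]
    rw [hn]
    linear_combination (wdeg v + 1) * e1 + e1' - gval v * ihu - gval u * ihv

/-! ### Flag vectors of the Boolean lattice -/

section Chains

variable {α : Type*}

open Classical in
/-- The chains of subsets of `A` whose sizes are exactly the elements of `T`. -/
def chainSet (A : Finset α) (T : Finset ℕ) : Finset (Finset (Finset α)) :=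
  {C ∈ A.powerset.powerset | IsChain (· ≤ ·) (C : Set (Finset α)) ∧ C.image Finset.card = T}

lemma mem_chainSet {A : Finset α} {T : Finset ℕ} {C : Finset (Finset α)} :
    C ∈ chainSet A T ↔ (∀ s ∈ C, s ⊆ A) ∧ IsChain (· ≤ ·) (C : Set (Finset α)) ∧
      C.image Finset.card = T := by
  simp [chainSet, Finset.subset_iff]

/-- A chain whose largest rank is `t` consists of its top element `B` and a chain of subsets of `B`
with ranks `T`. -/
lemma card_chainSet_insert [DecidableEq α] (A : Finset α) (T : Finset ℕ) (t : ℕ) (ht : ∀ s ∈ T, s < t) :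
    (chainSet A (insert t T)).card = ∑ B ∈ A.powersetCard t, (chainSet B T).card := by
  rw [← Finset.card_sigma]
  symm
  have hcard : ∀ (B : Finset α) (C : Finset (Finset α)), C ∈ chainSet B T →
      ∀ s ∈ C, s.card < t := by
    intro B C hC s hs
    rw [mem_chainSet] at hC
    exact ht _ (hC.2.2 ▸ Finset.mem_image_of_mem _ hs)
  refine Finset.card_bij (fun p _ => insert p.1 p.2) ?_ ?_ ?_
  · rintro ⟨B, C⟩ h
    simp only [Finset.mem_sigma, Finset.mem_powersetCard] at h
    obtain ⟨⟨hBA, hBt⟩, hC⟩ := h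
    rw [mem_chainSet] at hC ⊢
    obtain ⟨hCB, hch, him⟩ := hC
    refine ⟨?_, ?_, ?_⟩
    · intro s hs
      rcases Finset.mem_insert.1 hs with rfl | hs
      · exact hBA
      · exact (hCB s hs).trans hBA
    · rw [Finset.coe_insert]
      exact hch.insert fun s hs _ => Or.inr (hCB s hs)
    · rw [Finset.image_insert, him, hBt]
  · rintro ⟨B₁, C₁⟩ h₁ ⟨B₂, C₂⟩ h₂ e
    simp only [Finset.mem_sigma, Finset.mem_powersetCard] at h₁ h₂ e
    have n₁ : B₁ ∉ C₁ := fun h => (hcard _ _ h₁.2 _ h).ne h₁.1.2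
    have n₂ : B₂ ∉ C₂ := fun h => (hcard _ _ h₂.2 _ h).ne h₂.1.2
    have hB : B₁ = B₂ := by
      have : B₁ ∈ insert B₂ C₂ := e ▸ Finset.mem_insert_self _ _
      rcases Finset.mem_insert.1 this with h | h
      · exact h
      · exact absurd h₁.1.2 (hcard _ _ h₂.2 _ h).ne
    subst hB
    have : C₁ = C₂ := by
      rw [← Finset.erase_insert n₁, e, Finset.erase_insert n₂]
    rw [this]
  · intro C hC
    rw [mem_chainSet] at hC
    obtain ⟨hCA, hch, him⟩ := hC
    obtain ⟨B, hB, hBt⟩ : ∃ B ∈ C, B.card = t := by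
      have : t ∈ C.image Finset.card := him ▸ Finset.mem_insert_self _ _
      simpa using this
    have hle : ∀ s ∈ C, s.card ≤ t := by
      intro s hs
      have : s.card ∈ insert t T := him ▸ Finset.mem_image_of_mem _ hs
      rcases Finset.mem_insert.1 this with h | h
      · exact h.le
      · exact (ht _ h).le
    have hsub : ∀ s ∈ C, s ⊆ B := by
      intro s hs
      rcases hch.total hs hB with h | h
      · exact h
      · exact (Finset.eq_of_subset_of_card_le h (hBt ▸ hle s hs)).ge
    refine ⟨⟨B, C.erase B⟩, ?_, Finset.insert_erase hB⟩
    simp only [Finset.mem_sigma, Finset.mem_powersetCard]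
    refine ⟨⟨hCA B hB, hBt⟩, ?_⟩
    rw [mem_chainSet]
    refine ⟨fun s hs => hsub s (Finset.mem_of_mem_erase hs),
      hch.mono (by simp), ?_⟩
    ext r
    simp only [Finset.mem_image, Finset.mem_erase]
    constructor
    · rintro ⟨s, ⟨hsB, hs⟩, rfl⟩
      have : s.card ∈ insert t T := him ▸ Finset.mem_image_of_mem _ hs
      rcases Finset.mem_insert.1 this with h | h
      · exact absurd (Finset.eq_of_subset_of_card_le (hsub s hs) (by omega)) hsB
      · exact h
    · intro hr
      have : r ∈ C.image Finset.card := him ▸ Finset.mem_insert_of_mem hr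
      obtain ⟨s, hs, rfl⟩ := Finset.mem_image.1 this
      refine ⟨s, ⟨?_, hs⟩, rfl⟩
      rintro rfl
      exact (ht _ hr).ne hBt

lemma card_chainSet_empty (A : Finset α) : (chainSet A ∅).card = 1 := by
  rw [Finset.card_eq_one]
  refine ⟨∅, ?_⟩
  ext C
  rw [mem_chainSet, Finset.mem_singleton, Finset.image_eq_empty]
  constructor
  · exact fun h => h.2.2
  · rintro rfl; simp

end Chains

lemma flagF_eq_card_chainSet (N : ℕ) (T : Finset ℕ) :
    flagF (BooleanLattice N) T = (chainSet (Finset.univ : Finset (Fin N)) T).card := by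
  classical
  rw [flagF, Nat.card_eq_fintype_card, Fintype.card_subtype]
  congr 1
  ext C
  rw [mem_chainSet, Finset.mem_filter, ← Finset.coe_inj, Finset.coe_image]
  have : (grade ℕ : Finset (Fin N) → ℕ) = Finset.card := by
    funext s; exact Finset.grade_eq s
  simp [this]

lemma card_chainSet {α : Type} [DecidableEq α] (T : Finset ℕ) (A : Finset α) :
    (chainSet A T).card = flagF (BooleanLattice A.card) T := by
  induction T using Finset.induction_on_max generalizing α with
  | empty => rw [card_chainSet_empty, flagF_eq_card_chainSet, card_chainSet_empty]
  | insert t T ht ih =>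
    have key : ∀ {β : Type} [DecidableEq β] (A : Finset β),
        (chainSet A (insert t T)).card = A.card.choose t * flagF (BooleanLattice t) T := by
      intro β _ A
      rw [card_chainSet_insert A T t ht, ← smul_eq_mul, ← Finset.card_powersetCard,
        ← Finset.sum_const]
      refine Finset.sum_congr rfl fun B hB => ?_
      rw [ih B, (Finset.mem_powersetCard.1 hB).2]
    rw [key, flagF_eq_card_chainSet A.card, key, Finset.card_univ, Fintype.card_fin]

lemma flagF_boolean_insert (N t : ℕ) (T : Finset ℕ) (ht : ∀ s ∈ T, s < t) :
    flagF (BooleanLattice N) (insert t T) = N.choose t * flagF (BooleanLattice t) T := by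
  rw [flagF_eq_card_chainSet, card_chainSet_insert _ _ _ ht]
  simp only [card_chainSet]
  rw [Finset.sum_congr rfl fun B hB => by rw [(Finset.mem_powersetCard.1 hB).2]]
  simp

lemma flagF_boolean_empty (N : ℕ) : flagF (BooleanLattice N) ∅ = 1 := by
  rw [flagF_eq_card_chainSet, card_chainSet_empty]

/-- The alternating sum is divided according to whether the subset contains the new maximum `t`: if
so, a factor `N.choose t` comes out; if not, one more missing element flips the sign. -/
lemma flagH_boolean_insert (N t : ℕ) (S : Finset ℕ) (ht : ∀ s ∈ S, s < t) :
    flagH (BooleanLattice N) (insert t S) =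
      N.choose t * flagH (BooleanLattice t) S - flagH (BooleanLattice N) S := by
  have hS : t ∉ S := fun h => (ht t h).ne rfl
  simp only [flagH]
  rw [Finset.sum_powerset_insert hS, add_comm, Finset.mul_sum, sub_eq_add_neg,
    ← Finset.sum_neg_distrib]
  congr 1
  · refine Finset.sum_congr rfl fun T hT => ?_
    rw [Finset.mem_powerset] at hT
    rw [flagF_boolean_insert N t T fun s hs => ht s (hT hs), Finset.insert_sdiff_insert,
      Finset.sdiff_insert_of_notMem hS]
    push_cast; ring
  · refine Finset.sum_congr rfl fun T hT => ?_
    rw [Finset.mem_powerset] at hT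
    rw [Finset.insert_sdiff_of_notMem _ fun h => hS (hT h),
      Finset.card_insert_of_notMem fun h => hS (Finset.sdiff_subset h), pow_succ]
    ring

lemma toList_abWord_insert (t k : ℕ) (S : Finset ℕ) (ht : ∀ s ∈ S, s < t + 1) :
    (abWord (t + 1 + k) (insert (t + 1) S)).toList =
      (abWord t S).toList ++ AB.b :: List.replicate k AB.a := by
  simp only [abWord, FreeMonoid.toList_ofList, List.range_add, List.range_succ, List.map_append,
    List.append_assoc, List.map_cons, List.map_nil, List.map_map]
  congr 1
  · refine List.map_congr_left fun i hi => ?_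
    have : i ≠ t := by have := List.mem_range.1 hi; omega
    simp [this]
  · simp only [Finset.mem_insert, true_or, if_true, List.cons_append, List.nil_append,
      List.cons.injEq, true_and]
    rw [List.eq_replicate_iff]
    refine ⟨by simp, fun x hx => ?_⟩
    simp only [List.mem_map, Function.comp] at hx
    obtain ⟨i, -, rfl⟩ := hx
    rw [if_neg]
    rintro (h | h)
    · omega
    · have := ht _ h; omega

lemma toList_abWord_of_lt (t k : ℕ) (S : Finset ℕ) (ht : ∀ s ∈ S, s < t + 1) :
    (abWord (t + 1 + k) S).toList =
      (abWord t S).toList ++ AB.a :: List.replicate k AB.a := by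
  simp only [abWord, FreeMonoid.toList_ofList]
  rw [add_assoc, List.range_add, List.map_append, List.map_map]
  congr 1
  rw [← List.replicate_succ, List.eq_replicate_iff]
  refine ⟨by simp [add_comm], fun x hx => ?_⟩
  simp only [List.mem_map, Function.comp] at hx
  obtain ⟨i, -, rfl⟩ := hx
  rw [if_neg]
  intro h
  have := ht _ h; omega

lemma length_abWord (n : ℕ) (S : Finset ℕ) : (abWord n S).toList.length = n := by
  simp [abWord]

lemma abEval_gval_cut (x y : List AB) :
    abEval gval (x ++ AB.a :: y) + abEval gval (x ++ AB.b :: y) =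
      abEval gval x * abEval gval y := by
  rw [← abEval_cut]
  simp only [cut_gval, abEval_mul_left]
  simp only [mul_comm _ (abEval gval y), abEval_mul_left]

/-- The flag `h`-vector of the Boolean lattice. -/
theorem flagH_boolean (n : ℕ) (S : Finset ℕ) (hS : S ⊆ Finset.Icc 1 n) :
    (flagH (BooleanLattice (n + 1)) S : ℚ) =
      (n + 1).factorial * abEval gval (abWord n S).toList := by
  induction S using Finset.induction_on_max generalizing n with
  | empty =>
    have : (abWord n ∅).toList = List.replicate n AB.a := by
      simp only [abWord, FreeMonoid.toList_ofList]
      rw [List.eq_replicate_iff]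
      refine ⟨by simp, fun x hx => ?_⟩
      simp at hx; exact hx.2
    rw [this, abEval_replicate_a, gval_replicate_c]
    have : ((n + 1).factorial : ℚ) ≠ 0 := by positivity
    field_simp
    simp [flagH, flagF_boolean_empty]
  | insert t S ht ih =>
    have h1 := Finset.mem_Icc.1 (hS (Finset.mem_insert_self t S))
    obtain ⟨t, rfl⟩ : ∃ s, t = s + 1 := ⟨t - 1, by omega⟩
    obtain ⟨k, rfl⟩ : ∃ k, n = t + 1 + k := ⟨n - (t + 1), by omega⟩
    have hS' : S ⊆ Finset.Icc 1 (t + 1 + k) := (Finset.subset_insert _ _).trans hS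
    have hSt : S ⊆ Finset.Icc 1 t := fun s hs =>
      Finset.mem_Icc.2 ⟨(Finset.mem_Icc.1 (hS' hs)).1, by have := ht s hs; omega⟩
    rw [flagH_boolean_insert _ _ _ ht]
    push_cast
    rw [ih _ hSt, ih _ hS', toList_abWord_insert t k S ht, toList_abWord_of_lt t k S ht]
    -- As `t + 1` is the largest element, only `a`s follow its `b`. The cut relation at this place
    -- trades the `b` for an `a`, matching the recursion of the flag h-vector.
    have hc := abEval_gval_cut (abWord t S).toList (List.replicate k AB.a)
    rw [abEval_replicate_a, gval_replicate_c] at hc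
    have hch : ((t + 1 + k + 1).choose (t + 1) : ℚ) * (t + 1).factorial * (k + 1).factorial =
        (t + 1 + k + 1).factorial := by
      have := Nat.choose_mul_factorial_mul_factorial (n := t + 1 + k + 1) (k := t + 1) (by omega)
      rw [show t + 1 + k + 1 - (t + 1) = k + 1 by omega] at this
      exact_mod_cast this
    have hk : ((k + 1).factorial : ℚ) ≠ 0 := by positivity
    rw [← sub_eq_iff_eq_add'.2 hc.symm]
    rw [← hch]
    field_simp

/-! ### The cd-index of the Boolean lattice -/

lemma coeff_monom_of_mul_one {X : Type} (x : X) (p : NCPoly X) :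
    (monom (FreeMonoid.of x) * p).coeff 1 = 0 := by
  refine MonoidAlgebra.coeff_single_mul_of_forall_mul_ne _ _ fun d h => ?_
  have := congrArg FreeMonoid.length h
  simp at this

lemma coeff_monom_of_mul_of_mul {X : Type} (x : X) (p : NCPoly X) (w : FreeMonoid X) :
    (monom (FreeMonoid.of x) * p).coeff (FreeMonoid.of x * w) = p.coeff w := by
  rw [monom, MonoidAlgebra.coeff_single_mul_mul, one_mul]

lemma coeff_monom_of_mul_of_mul_ne {X : Type} {x y : X} (h : x ≠ y) (p : NCPoly X)
    (w : FreeMonoid X) : (monom (FreeMonoid.of x) * p).coeff (FreeMonoid.of y * w) = 0 := by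
  refine MonoidAlgebra.coeff_single_mul_of_forall_mul_ne _ _ fun d e => h ?_
  have := congrArg FreeMonoid.toList e
  simp at this
  exact this.1

lemma coeff_letterToAB_c_mul_one (p : NCPoly AB) : (letterToAB CD.c * p).coeff 1 = 0 := by
  simp [letterToAB, add_mul, coeff_monom_of_mul_one]

lemma coeff_letterToAB_c_mul (p : NCPoly AB) (x : AB) (w : FreeMonoid AB) :
    (letterToAB CD.c * p).coeff (FreeMonoid.of x * w) = p.coeff w := by
  cases x <;> simp [letterToAB, add_mul, coeff_monom_of_mul_of_mul,
    coeff_monom_of_mul_of_mul_ne]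

lemma monom_mul {X : Type} (v w : FreeMonoid X) : monom (v * w) = monom v * monom w := by
  simp [monom, MonoidAlgebra.single_mul_single]

lemma coeff_letterToAB_d_mul_one (p : NCPoly AB) : (letterToAB CD.d * p).coeff 1 = 0 := by
  simp [letterToAB, add_mul, monom_mul, mul_assoc, coeff_monom_of_mul_one]

lemma coeff_letterToAB_d_mul_of (p : NCPoly AB) (x : AB) :
    (letterToAB CD.d * p).coeff (FreeMonoid.of x) = 0 := by
  rw [← mul_one (FreeMonoid.of x)]
  cases x <;> simp only [letterToAB, add_mul, monom_mul, mul_assoc, MonoidAlgebra.coeff_add,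
    Finsupp.add_apply, coeff_monom_of_mul_of_mul, coeff_monom_of_mul_one,
    coeff_monom_of_mul_of_mul_ne, ne_eq, reduceCtorEq, not_false_eq_true, add_zero]

lemma coeff_letterToAB_d_mul (p : NCPoly AB) (x y : AB) (w : FreeMonoid AB) :
    (letterToAB CD.d * p).coeff (FreeMonoid.of x * (FreeMonoid.of y * w)) =
      differ x y * p.coeff w := by
  cases x <;> cases y <;>
    simp only [letterToAB, add_mul, monom_mul, mul_assoc, MonoidAlgebra.coeff_add,
      Finsupp.add_apply, coeff_monom_of_mul_of_mul, differ,
      coeff_monom_of_mul_of_mul_ne, ne_eq, reduceCtorEq, not_false_eq_true, add_zero, zero_add,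
      zero_mul, one_mul]

lemma coeff_prod_letterToAB (v : List CD) (w : List AB) :
    ((v.map letterToAB).prod).coeff (FreeMonoid.ofList w) =
      abEval (fun v' => (MonoidAlgebra.single (FreeMonoid.ofList v) 1 : NCPoly CD).coeff
        (FreeMonoid.ofList v')) w := by
  classical
  simp only [MonoidAlgebra.coeff_single, Finsupp.single_apply, EmbeddingLike.apply_eq_iff_eq]
  induction v generalizing w with
  | nil =>
    rcases w with _ | ⟨x, _ | ⟨y, w⟩⟩
    · simp [MonoidAlgebra.one_def]
    · simp [MonoidAlgebra.one_def]
    · simp [abEval_cons_cons, abEval_zero, MonoidAlgebra.one_def]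
  | cons l v ih =>
    rw [List.map_cons, List.prod_cons]
    cases l
    · rcases w with _ | ⟨x, _ | ⟨y, w⟩⟩
      · simp [coeff_letterToAB_c_mul_one]
      · have := ih []
        rw [FreeMonoid.ofList_cons, coeff_letterToAB_c_mul, this]
        simp
      · rw [FreeMonoid.ofList_cons, coeff_letterToAB_c_mul, ih]
        simp [abEval_cons_cons _ x, abEval_zero]
    · rcases w with _ | ⟨x, _ | ⟨y, w⟩⟩
      · simp [coeff_letterToAB_d_mul_one]
      · simp [coeff_letterToAB_d_mul_of]
      · rw [FreeMonoid.ofList_cons, FreeMonoid.ofList_cons, coeff_letterToAB_d_mul, ih]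
        simp [abEval_cons_cons _ x, abEval_zero]

lemma coeff_cdToAB (Φ : NCPoly CD) (w : List AB) :
    (cdToAB Φ).coeff (FreeMonoid.ofList w) =
      abEval (fun v => Φ.coeff (FreeMonoid.ofList v)) w := by
  induction Φ using MonoidAlgebra.induction_linear with
  | zero => simp [abEval_zero]
  | add p q hp hq => simp [hp, hq, abEval_add]
  | single m r =>
    have h := coeff_prod_letterToAB m.toList w
    rw [cdToAB, MonoidAlgebra.lift_single, FreeMonoid.lift_apply, MonoidAlgebra.coeff_smul,
      Finsupp.smul_apply, h, smul_eq_mul, ← abEval_mul_left]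
    refine abEval_congr fun v _ => ?_
    rw [FreeMonoid.ofList_toList, MonoidAlgebra.coeff_single, MonoidAlgebra.coeff_single,
      ← smul_eq_mul, ← Finsupp.smul_apply, Finsupp.smul_single, smul_eq_mul, mul_one]

lemma wdeg_toList (v : FreeMonoid CD) : wdeg v.toList = degree v := by
  rw [degree]
  induction v.toList with
  | nil => rfl
  | cons x v ih => simp [wdeg, ih]

lemma grade_top_booleanLattice (N : ℕ) : grade ℕ (⊤ : BooleanLattice N) = N := by
  simp [BooleanLattice, Finset.top_eq_univ]

lemma abWord_injOn (n : ℕ) {S T : Finset ℕ} (hS : S ⊆ Finset.Icc 1 n) (hT : T ⊆ Finset.Icc 1 n)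
    (h : abWord n S = abWord n T) : S = T := by
  have h' : ∀ i < n, (i + 1 ∈ S ↔ i + 1 ∈ T) := by
    intro i hi
    have := congrArg FreeMonoid.toList h
    simp only [abWord, FreeMonoid.toList_ofList] at this
    have := List.map_inj_left.1 this i (List.mem_range.2 hi)
    by_cases h1 : i + 1 ∈ S <;> by_cases h2 : i + 1 ∈ T <;> simp_all
  ext i
  by_cases hi : i ∈ Finset.Icc 1 n
  · have h1 := Finset.mem_Icc.1 hi
    have := h' (i - 1) (by omega)
    rwa [show i - 1 + 1 = i by omega] at this
  · exact ⟨fun h => absurd (hS h) hi, fun h => absurd (hT h) hi⟩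

lemma exists_abWord_eq (w : List AB) :
    ∃ S ⊆ Finset.Icc 1 w.length, abWord w.length S = FreeMonoid.ofList w := by
  classical
  refine ⟨(Finset.Icc 1 w.length).filter fun i => w[i - 1]? = some AB.b,
    Finset.filter_subset _ _, ?_⟩
  rw [abWord]
  congr 1
  refine List.ext_getElem (by simp) fun i h1 h2 => ?_
  simp only [List.getElem_map, List.getElem_range, Finset.mem_filter, Finset.mem_Icc,
    Nat.add_sub_cancel, List.getElem?_eq_getElem h2]
  cases h : w[i]
  · simp
  · simp; omega

lemma coeff_abIndex_boolean (n : ℕ) (w : List AB) :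
    (abIndex (BooleanLattice (n + 1))).coeff (FreeMonoid.ofList w) =
      if w.length = n then (n + 1).factorial * abEval gval w else 0 := by
  rw [abIndex, MonoidAlgebra.coeff_sum, Finsupp.finsetSum_apply, grade_top_booleanLattice,
    Nat.add_sub_cancel]
  have hterm : ∀ S, ((flagH (BooleanLattice (n + 1)) S : ℚ) • monom (abWord n S)).coeff
      (FreeMonoid.ofList w) =
      (flagH (BooleanLattice (n + 1)) S : ℚ) * Finsupp.single (abWord n S) 1
        (FreeMonoid.ofList w) := fun S => rfl
  simp only [hterm]
  split_ifs with hw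
  · subst hw
    obtain ⟨S, hS, e⟩ := exists_abWord_eq w
    rw [Finset.sum_eq_single_of_mem S (Finset.mem_powerset.2 hS), flagH_boolean _ _ hS, e]
    · simp
    · intro T hT hTS
      rw [Finsupp.single_eq_of_ne, mul_zero]
      intro h
      exact hTS (abWord_injOn _ (Finset.mem_powerset.1 hT) hS (by rw [e, h]))
  · refine Finset.sum_eq_zero fun S _ => ?_
    rw [Finsupp.single_eq_of_ne, mul_zero]
    intro h
    apply hw
    rw [← length_abWord n S, ← h]
    rfl

lemma length_le_wdeg (v : List CD) : v.length ≤ wdeg v := by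
  induction v with
  | nil => simp
  | cons x v ih => cases x <;> simp <;> omega

lemma finite_wdeg_eq (n : ℕ) : {v : FreeMonoid CD | wdeg v.toList = n}.Finite := by
  have : Finite CD := Finite.of_surjective (fun b : Bool => if b then CD.c else CD.d)
    (by rintro (_ | _); exacts [⟨true, rfl⟩, ⟨false, rfl⟩])
  refine (List.finite_length_le CD n).subset fun v hv => ?_
  exact (length_le_wdeg v).trans_eq hv

/-- The witness has coefficients (n + 1)! `gval` in degree n and zero elsewhere. Its support is
finite because a word is no longer than its degree. -/
lemma isCDIndex_boolean (n : ℕ) : ∃ Φ, IsCDIndex (BooleanLattice (n + 1)) Φ := by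
  classical
  let f : FreeMonoid CD → ℚ := fun v =>
    if wdeg v.toList = n then (n + 1).factorial * gval v.toList else 0
  have hf : f.support.Finite := (finite_wdeg_eq n).subset fun v hv => by
    by_contra h
    exact hv (if_neg h)
  refine ⟨MonoidAlgebra.ofCoeff (Finsupp.ofSupportFinite f hf), ?_⟩
  rw [IsCDIndex, ← MonoidAlgebra.coeff_inj]
  ext w
  have h1 := coeff_cdToAB (MonoidAlgebra.ofCoeff (Finsupp.ofSupportFinite f hf)) w.toList
  have h2 := coeff_abIndex_boolean n w.toList
  rw [FreeMonoid.ofList_toList] at h1 h2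
  rw [h1, h2]
  split_ifs with hw
  · rw [← abEval_mul_left]
    refine abEval_congr fun v hv => ?_
    exact if_pos (hv.trans hw)
  · rw [← abEval_zero w.toList]
    refine abEval_congr fun v hv => ?_
    exact if_neg fun h => hw (hv.symm.trans h)

/-- The coefficients of the **cd**-index of the Boolean lattice. -/
theorem betaMonomial_eq (v : FreeMonoid CD) :
    betaMonomial v = (degree v + 1).factorial * gval v.toList := by
  have hΦ : IsCDIndex (BooleanLattice (degree v + 1)) (cdIndex (BooleanLattice (degree v + 1))) := by
    rw [cdIndex, dif_pos (isCDIndex_boolean _)]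
    exact (isCDIndex_boolean _).choose_spec
  rw [betaMonomial, coefficient]
  set Φ := cdIndex (BooleanLattice (degree v + 1))
  rw [← sub_eq_zero, sub_eq_add_neg, ← neg_mul]
  -- The chosen polynomial is determined by its image in ab-words, by injectivity of the
  -- substitution in each degree.
  refine eq_zero_of_abEval v.toList (fun u => Φ.coeff (FreeMonoid.ofList u) +
    -((degree v + 1).factorial : ℚ) * gval u) fun w hw => ?_
  rw [abEval_add, abEval_mul_left, ← coeff_cdToAB, hΦ, coeff_abIndex_boolean,
    if_pos (hw.trans (wdeg_toList v))]
  ring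

/-! ### Words with explicit final blocks and the quotient bounds -/

/-- The word `cⁿ`. -/
abbrev cpow (n : ℕ) : List CD := List.replicate n CD.c

/-- Blocks of `c` offer no split, so beyond the terms internal to `x` only the displayed `d`
contributes. -/
lemma gval_rec_left_one (x : List CD) (p : ℕ) :
    ((wdeg x + p + 2 : ℕ) : ℚ) * ((wdeg x + p + 2 : ℕ) + 1) * gval (x ++ CD.d :: cpow p) =
      ((wdeg x + p + 2 : ℕ) : ℚ) * firstC (fun x' => gval (x' ++ CD.d :: cpow p)) x +
      splitD (fun u w => ((wdeg w : ℚ) + p + 3) * (gval u * gval (w ++ CD.d :: cpow p))) x +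
      ((p : ℚ) + 1) * (gval x * gval (cpow p)) := by
  have h := gval_rec_left (x ++ CD.d :: cpow p)
  have hd : wdeg (x ++ CD.d :: cpow p) = wdeg x + p + 2 := by simp; omega
  rw [hd, firstC_append_d, splitD_append, splitD_d, splitD_replicate_c] at h
  rw [h]
  simp only [List.append_nil, wdeg_append, wdeg_d, wdeg_replicate_c, add_zero]
  rw [← add_assoc]
  congr 2
  refine splitD_congr fun u w _ => ?_
  push_cast; ring

lemma gval_rec_left_two (x : List CD) (m n : ℕ) :
    ((wdeg x + m + n + 4 : ℕ) : ℚ) * ((wdeg x + m + n + 4 : ℕ) + 1) *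
        gval (x ++ CD.d :: (cpow m ++ CD.d :: cpow n)) =
      ((wdeg x + m + n + 4 : ℕ) : ℚ) *
        firstC (fun x' => gval (x' ++ CD.d :: (cpow m ++ CD.d :: cpow n))) x +
      splitD (fun u w => ((wdeg w : ℚ) + m + n + 5) *
        (gval u * gval (w ++ CD.d :: (cpow m ++ CD.d :: cpow n)))) x +
      ((m : ℚ) + n + 3) * (gval x * gval (cpow m ++ CD.d :: cpow n)) +
      ((n : ℚ) + 1) * (gval (x ++ CD.d :: cpow m) * gval (cpow n)) := by
  have h := gval_rec_left (x ++ CD.d :: (cpow m ++ CD.d :: cpow n))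
  have hd : wdeg (x ++ CD.d :: (cpow m ++ CD.d :: cpow n)) = wdeg x + m + n + 4 := by simp; omega
  rw [hd, firstC_append_d, splitD_append, splitD_d, splitD_append, splitD_d, splitD_replicate_c,
    splitD_replicate_c] at h
  rw [h]
  simp only [List.append_nil, wdeg_append, wdeg_d, wdeg_replicate_c, add_zero, zero_add]
  rw [← add_assoc, ← add_assoc]
  congr 2
  · congr 1
    refine splitD_congr fun u w _ => ?_
    push_cast; ring
  · push_cast; ring

lemma gval_c_d_c (p q : ℕ) : gval (cpow p ++ CD.d :: cpow q) =
    (1 / ((p + 1).factorial * (q + 1).factorial) - 1 / (p + q + 2).factorial) / (p + q + 3) := by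
  have hq : ((q + 1).factorial : ℚ) ≠ 0 := by positivity
  induction p with
  | zero =>
    have h := gval_rec_left_one [] q
    simp only [wdeg_nil, firstC_nil, splitD_nil, gval_replicate_c, gval_nil] at h
    have : gval (cpow 0 ++ CD.d :: cpow q) = gval ([] ++ CD.d :: cpow q) := rfl
    rw [this, zero_add, zero_add, Nat.factorial_succ (q + 1)]
    rw [zero_add] at h
    push_cast at h ⊢
    have h2 : (q : ℚ) + 1 + 1 ≠ 0 := by positivity
    have h3 : (q : ℚ) + 3 ≠ 0 := by positivity
    simp only [Nat.factorial_one, Nat.cast_one]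
    field_simp at h ⊢
    linear_combination h
  | succ p ih =>
    have h := gval_rec_left_one (cpow (p + 1)) q
    rw [splitD_replicate_c, wdeg_replicate_c, gval_replicate_c, gval_replicate_c] at h
    rw [show firstC (fun x' => gval (x' ++ CD.d :: cpow q)) (cpow (p + 1)) =
      gval (cpow p ++ CD.d :: cpow q) from rfl, ih] at h
    have e1 : (p + 1 + q + 2).factorial = (p + q + 3) * (p + q + 2).factorial := by
      rw [show p + 1 + q + 2 = (p + q + 2) + 1 by ring, Nat.factorial_succ]
    rw [e1, Nat.factorial_succ (p + 1)]
    rw [Nat.factorial_succ (p + 1)] at h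
    have hp : ((p + 1).factorial : ℚ) ≠ 0 := by positivity
    have hpq : ((p + q + 2).factorial : ℚ) ≠ 0 := by positivity
    have h3 : (p : ℚ) + q + 3 ≠ 0 := by positivity
    have h4 : (p : ℚ) + 1 + q + 2 ≠ 0 := by positivity
    have h5 : (p : ℚ) + 1 + q + 3 ≠ 0 := by positivity
    have h5' : (p : ℚ) + 1 + q + 2 + 1 ≠ 0 := by positivity
    have h6 : (p : ℚ) + 1 + 1 ≠ 0 := by positivity
    push_cast at h ⊢
    refine mul_left_cancel₀ (mul_ne_zero h4 h5') (h.trans ?_)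
    field_simp
    ring

lemma gval_c_d_c_comm (p q : ℕ) :
    gval (cpow p ++ CD.d :: cpow q) = gval (cpow q ++ CD.d :: cpow p) := by
  rw [gval_c_d_c, gval_c_d_c, mul_comm ((p + 1).factorial : ℚ), add_comm p q,
    add_comm (p : ℚ) q]

lemma gval_c_d (k : ℕ) : gval (cpow k ++ [CD.d]) = ((k : ℚ) + 1) * gval (cpow (k + 2)) := by
  have h := gval_c_d_c k 0
  rw [show cpow 0 = [] from rfl] at h
  rw [h, gval_replicate_c, show k + 0 + 2 = k + 1 + 1 by ring, Nat.factorial_succ (k + 1 + 1),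
    Nat.factorial_succ (k + 1)]
  have hp : ((k + 1).factorial : ℚ) ≠ 0 := by positivity
  push_cast
  field_simp
  ring

/-- Both words have the same degree, so their one-sided recursions compare term by term. By
`gval_c_d` the splits at the common `d` agree exactly; the split at the final `d` is a nonnegative
surplus. -/
lemma le_gval_append_d_c_d (x : List CD) (k : ℕ) :
    ((k : ℚ) + 1) * gval (x ++ CD.d :: cpow (k + 2)) ≤
      gval (x ++ CD.d :: (cpow k ++ [CD.d])) := by
  induction h : x.length using Nat.strong_induction_on generalizing x with
  | _ n ih =>
  subst h
  have h1 := gval_rec_left_one x (k + 2)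
  have h2 := gval_rec_left_two x k 0
  rw [show cpow 0 = [] from rfl, gval_nil, gval_c_d] at h2
  rw [show wdeg x + (k + 2) + 2 = wdeg x + k + 0 + 4 by ring] at h1
  set N : ℚ := ((wdeg x + k + 0 + 4 : ℕ) : ℚ) with hN
  have hN0 : 0 < N * (N + 1) := by positivity
  have hF : ((k : ℚ) + 1) * firstC (fun x' => gval (x' ++ CD.d :: cpow (k + 2))) x ≤
      firstC (fun x' => gval (x' ++ CD.d :: (cpow k ++ [CD.d]))) x := by
    rw [← firstC_mul_left]
    exact firstC_mono fun w e => ih _ (by simp [e]) w rfl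
  have hS : ((k : ℚ) + 1) * splitD (fun u w => ((wdeg w : ℚ) + (k + 2 : ℕ) + 3) *
        (gval u * gval (w ++ CD.d :: cpow (k + 2)))) x ≤
      splitD (fun u w => ((wdeg w : ℚ) + k + (0 : ℕ) + 5) *
        (gval u * gval (w ++ CD.d :: (cpow k ++ [CD.d])))) x := by
    rw [← splitD_mul_left]
    refine splitD_mono fun u w e => ?_
    have := ih w.length (by simp [e]; omega) w rfl
    have hu := gval_nonneg u
    calc _ = ((wdeg w : ℚ) + k + (0 : ℕ) + 5) * (gval u *
          (((k : ℚ) + 1) * gval (w ++ CD.d :: cpow (k + 2)))) := by push_cast; ring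
      _ ≤ _ := by gcongr
  have h3 := gval_nonneg (x ++ CD.d :: cpow k)
  have hNF := mul_le_mul_of_nonneg_left hF (show 0 ≤ N by positivity)
  refine le_of_mul_le_mul_left ?_ hN0
  push_cast at h1 h2 hS
  linear_combination ((k : ℚ) + 1) * h1 - h2 + hNF + hS + h3

/-- The cut relation for `x` and `cpow (k + 1)`, with its other, nonnegative terms discarded;
strictness comes from positivity of `gval`. -/
lemma gval_append_d_c_lt (x : List CD) (k : ℕ) :
    gval (x ++ CD.d :: cpow k) < gval x / (k + 2).factorial := by
  have h := cut_gval x (cpow (k + 1))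
  rw [cut, gval_replicate_c, show firstC (fun v' => gval (x ++ CD.d :: v')) (cpow (k + 1)) =
    gval (x ++ CD.d :: cpow k) from rfl] at h
  have h1 := gval_pos (x ++ CD.c :: cpow (k + 1))
  have h2 : 0 ≤ lastC (fun u' => gval (u' ++ CD.d :: cpow (k + 1))) x :=
    lastC_nonneg fun w _ => gval_nonneg _
  rw [mul_one_div] at h
  linarith

lemma gval_append_d_c_d_lt (x : List CD) (k : ℕ) :
    gval (x ++ CD.d :: (cpow k ++ [CD.d])) <
      ((k : ℚ) + 2) * gval (x ++ CD.d :: cpow (k + 2)) := by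
  induction h : x.length using Nat.strong_induction_on generalizing x with
  | _ n ih =>
  subst h
  have h1 := gval_rec_left_one x (k + 2)
  have h2 := gval_rec_left_two x k 0
  rw [show cpow 0 = [] from rfl, gval_nil, gval_c_d] at h2
  rw [show wdeg x + (k + 2) + 2 = wdeg x + k + 0 + 4 by ring] at h1
  set N : ℚ := ((wdeg x + k + 0 + 4 : ℕ) : ℚ) with hN
  have hN0 : 0 < N * (N + 1) := by positivity
  have hF : firstC (fun x' => gval (x' ++ CD.d :: (cpow k ++ [CD.d]))) x ≤
      ((k : ℚ) + 2) * firstC (fun x' => gval (x' ++ CD.d :: cpow (k + 2))) x := by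
    rw [← firstC_mul_left]
    exact firstC_mono fun w e => (ih _ (by simp [e]) w rfl).le
  have hS : splitD (fun u w => ((wdeg w : ℚ) + k + (0 : ℕ) + 5) *
        (gval u * gval (w ++ CD.d :: (cpow k ++ [CD.d])))) x ≤
      ((k : ℚ) + 2) * splitD (fun u w => ((wdeg w : ℚ) + (k + 2 : ℕ) + 3) *
        (gval u * gval (w ++ CD.d :: cpow (k + 2)))) x := by
    rw [← splitD_mul_left]
    refine splitD_mono fun u w e => ?_
    have := (ih w.length (by simp [e]; omega) w rfl).le
    have hu := gval_nonneg u
    calc _ ≤ ((wdeg w : ℚ) + k + (0 : ℕ) + 5) * (gval u *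
          (((k : ℚ) + 2) * gval (w ++ CD.d :: cpow (k + 2)))) := by gcongr
      _ = _ := by push_cast; ring
  -- The surplus of the split at the final `d` is less than the gain from replacing the factor k + 1
  -- by k + 2, as `h4` shows.
  have h3 := gval_append_d_c_lt x k
  have h4 : gval x / (k + 2).factorial = ((k : ℚ) + 3) * (gval x * gval (cpow (k + 2))) := by
    rw [gval_replicate_c, Nat.factorial_succ (k + 2)]
    have hp : ((k + 2).factorial : ℚ) ≠ 0 := by positivity
    push_cast
    field_simp
    ring
  have hNF := mul_le_mul_of_nonneg_left hF (show 0 ≤ N by positivity)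
  refine lt_of_mul_lt_mul_left ?_ hN0.le
  push_cast at h1 h2 hS
  rw [h4] at h3
  linear_combination h2 - ((k : ℚ) + 2) * h1 + hNF + hS + h3

lemma gval_append_d_c_zero (x : List CD) :
    gval (x ++ [CD.d]) = 2 * gval (x ++ [CD.d, CD.c]) := by
  have h := cut_gval (x ++ [CD.d]) []
  rw [cut, lastC_d] at h
  simp at h
  exact h.symm

/-- The cut relation with empty right factor. It turns the bounds k + 1 and k + 2 for a final `d`
into quotient bounds k + 3 and k + 4. -/
lemma gval_append_d_c_succ (x : List CD) (k : ℕ) : gval (x ++ CD.d :: cpow (k + 1)) =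
    2 * gval (x ++ CD.d :: cpow (k + 2)) + gval (x ++ CD.d :: (cpow k ++ [CD.d])) := by
  have h := cut_gval (x ++ CD.d :: cpow (k + 1)) []
  rw [cut, lastC_append_d] at h
  nth_rewrite 2 [cpow] at h
  rw [List.replicate_succ', lastC_c, gval_nil, mul_one, firstC_nil, add_zero] at h
  rw [← h, cpow, cpow, List.replicate_succ' (n := k + 1)]
  simp

/-- The quotient bounds for appending a letter `c`. -/
lemma gval_append_d_c_succ_le (x : List CD) (p : ℕ) :
    ((p : ℚ) + 2) * gval (x ++ CD.d :: cpow (p + 1)) ≤ gval (x ++ CD.d :: cpow p) := by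
  rcases p with _ | k
  · have := gval_append_d_c_zero x
    simp [cpow] at this ⊢
    linarith
  · have h1 := gval_append_d_c_succ x k
    have h2 := le_gval_append_d_c_d x k
    push_cast
    linarith

lemma lt_gval_append_d_c_succ (x : List CD) (p : ℕ) :
    gval (x ++ CD.d :: cpow p) < ((p : ℚ) + 3) * gval (x ++ CD.d :: cpow (p + 1)) := by
  rcases p with _ | k
  · have := gval_append_d_c_zero x
    have h := gval_pos (x ++ [CD.d, CD.c])
    simp [cpow] at this ⊢
    linarith
  · have h1 := gval_append_d_c_succ x k
    have h2 := gval_append_d_c_d_lt x k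
    push_cast
    linarith

lemma eq_cpow_or_eq_append (u : List CD) :
    (∃ l, u = cpow l) ∨ ∃ x l, u = x ++ CD.d :: cpow l := by
  induction u using List.reverseRecOn with
  | nil => exact Or.inl ⟨0, rfl⟩
  | append_singleton u a ih =>
    cases a
    · rcases ih with ⟨l, rfl⟩ | ⟨x, l, rfl⟩
      · exact Or.inl ⟨l + 1, List.replicate_succ'.symm⟩
      · exact Or.inr ⟨x, l + 1, by simp [List.replicate_succ']⟩
    · exact Or.inr ⟨u, 0, rfl⟩

/-- Final `c`s of `u` only lengthen the block and so strengthen the bound; if `u` has no `d`,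
factorials decide. -/
lemma gval_append_c_succ_le (u : List CD) (p : ℕ) :
    ((p : ℚ) + 2) * gval (u ++ cpow (p + 1)) ≤ gval (u ++ cpow p) := by
  rcases eq_cpow_or_eq_append u with ⟨l, rfl⟩ | ⟨x, l, rfl⟩
  · rw [cpow, cpow, cpow, List.replicate_append_replicate, List.replicate_append_replicate,
      gval_replicate_c, gval_replicate_c, ← add_assoc, Nat.factorial_succ (l + p + 1)]
    have : ((l + p + 1).factorial : ℚ) ≠ 0 := by positivity
    push_cast
    rw [mul_one_div, div_le_div_iff₀ (by positivity) (by positivity)]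
    have h : (0 : ℚ) ≤ (l + p + 1).factorial * l := by positivity
    linear_combination h
  · rw [List.append_assoc, List.append_assoc, List.cons_append, List.cons_append,
      cpow, cpow, cpow, List.replicate_append_replicate, List.replicate_append_replicate,
      ← add_assoc]
    have h := gval_append_d_c_succ_le x (l + p)
    have h2 := gval_nonneg (x ++ CD.d :: cpow (l + p + 1))
    push_cast at h
    nlinarith [mul_nonneg (Nat.cast_nonneg (α := ℚ) l) h2]

/-! ### A pair at the end of the list -/

lemma StrictlyBetterBalanced.min_lt {m₁ n₁ m₂ n₂ : ℕ} (h : StrictlyBetterBalanced m₁ n₁ m₂ n₂) :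
    min m₂ n₂ < min m₁ n₁ := by
  obtain ⟨h1, h2⟩ := h
  rcases abs_cases ((m₁ : ℤ) - n₁) with h3 | h3 <;>
    rcases abs_cases ((m₂ : ℤ) - n₂) with h4 | h4 <;> omega

lemma StrictlyBetterBalanced.swap {m₁ n₁ m₂ n₂ : ℕ} (h : StrictlyBetterBalanced m₁ n₁ m₂ n₂) :
    StrictlyBetterBalanced n₁ m₁ n₂ m₂ :=
  ⟨by have := h.1; omega, by rw [abs_sub_comm, abs_sub_comm (n₂ : ℤ)]; exact h.2⟩

lemma factorial_mul_factorial_le {a b c d : ℕ} (h : a + d = b + c) (hb : a ≤ b) (hc : a ≤ c) :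
    b.factorial * c.factorial ≤ a.factorial * d.factorial := by
  obtain ⟨k, rfl⟩ := Nat.exists_eq_add_of_le hb
  obtain rfl : d = c + k := by omega
  rw [← Nat.factorial_mul_ascFactorial, ← Nat.factorial_mul_ascFactorial, mul_right_comm,
    ← mul_assoc]
  exact Nat.mul_le_mul_left _ (Nat.ascFactorial_le k (by omega))

lemma antitone_factorial_mul_gval (x : List CD) :
    Antitone fun j : ℕ => (j.factorial : ℚ) * gval (x ++ CD.d :: cpow j) := by
  refine antitone_nat_of_succ_le fun j => ?_
  have h := gval_append_d_c_succ_le x j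
  have h0 := gval_nonneg (x ++ CD.d :: cpow (j + 1))
  rw [Nat.factorial_succ]
  push_cast
  have : ((j : ℚ) + 1) * gval (x ++ CD.d :: cpow (j + 1)) ≤ gval (x ++ CD.d :: cpow j) := by
    linarith
  calc _ = (j.factorial : ℚ) * (((j : ℚ) + 1) * gval (x ++ CD.d :: cpow (j + 1))) := by ring
    _ ≤ _ := by gcongr

/-- The unbalanced pair of final entries with the smaller entry first is at least as good. -/
lemma gval_two_swap_le (x : List CD) {m n : ℕ} (hmn : m ≤ n) :
    gval (x ++ CD.d :: (cpow n ++ CD.d :: cpow m)) ≤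
      gval (x ++ CD.d :: (cpow m ++ CD.d :: cpow n)) := by
  induction h : x.length using Nat.strong_induction_on generalizing x with
  | _ l ih =>
  subst h
  have h1 := gval_rec_left_two x n m
  have h2 := gval_rec_left_two x m n
  rw [gval_c_d_c_comm n m, show wdeg x + n + m + 4 = wdeg x + m + n + 4 by ring] at h1
  set N : ℚ := ((wdeg x + m + n + 4 : ℕ) : ℚ) with hN
  have hN0 : 0 < N * (N + 1) := by positivity
  have hF := firstC_mono (v := x)
    (K := fun x' => gval (x' ++ CD.d :: (cpow n ++ CD.d :: cpow m)))
    (K' := fun x' => gval (x' ++ CD.d :: (cpow m ++ CD.d :: cpow n)))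
    fun w e => ih _ (by simp [e]) w rfl
  have hS : splitD (fun u w => ((wdeg w : ℚ) + n + m + 5) *
        (gval u * gval (w ++ CD.d :: (cpow n ++ CD.d :: cpow m)))) x ≤
      splitD (fun u w => ((wdeg w : ℚ) + m + n + 5) *
        (gval u * gval (w ++ CD.d :: (cpow m ++ CD.d :: cpow n)))) x := by
    refine splitD_mono fun u w e => ?_
    have := ih w.length (by simp [e]; omega) w rfl
    have hu := gval_nonneg u
    rw [add_right_comm (wdeg w : ℚ)]
    gcongr
  -- Splits at the first displayed `d` agree by `gval_c_d_c_comm`, so only those at the last `d`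
  -- need comparison.
  have hmid : ((m : ℚ) + 1) * (gval (x ++ CD.d :: cpow n) * gval (cpow m)) ≤
      ((n : ℚ) + 1) * (gval (x ++ CD.d :: cpow m) * gval (cpow n)) := by
    have h := antitone_factorial_mul_gval x hmn
    simp only at h
    rw [gval_replicate_c, gval_replicate_c, Nat.factorial_succ, Nat.factorial_succ]
    have hm : (0 : ℚ) < m.factorial := by positivity
    have hn : (0 : ℚ) < n.factorial := by positivity
    push_cast
    calc _ = gval (x ++ CD.d :: cpow n) / m.factorial := by field_simp
      _ ≤ gval (x ++ CD.d :: cpow m) / n.factorial := by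
        rw [div_le_div_iff₀ hm hn]; linarith
      _ = _ := by field_simp
  have hNF := mul_le_mul_of_nonneg_left hF (show 0 ≤ N by positivity)
  refine le_of_mul_le_mul_left ?_ hN0
  linear_combination h1 - h2 + hNF + hS + hmid

/-- By the cut relation for `x` and `cpow (j + 1)`, the defect is (j + 1)! times the terms dropped
in `gval_append_d_c_lt`. The quotient bounds make these decrease faster than the factorial grows. -/
lemma strictAnti_gval_defect (x : List CD) : StrictAnti fun j : ℕ =>
    gval x / (j + 2) - (j + 1).factorial * gval (x ++ CD.d :: cpow j) := by
  have key : ∀ j : ℕ, gval x / (j + 2) - (j + 1).factorial * gval (x ++ CD.d :: cpow j) =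
      (j + 1).factorial * (2 * gval (x ++ cpow (j + 2)) +
        lastC (fun u => gval (u ++ CD.d :: cpow (j + 1))) x) := by
    intro j
    have h := cut_gval x (cpow (j + 1))
    rw [cut, gval_replicate_c, show firstC (fun v' => gval (x ++ CD.d :: v')) (cpow (j + 1)) =
      gval (x ++ CD.d :: cpow j) from rfl, show CD.c :: cpow (j + 1) = cpow (j + 2) from rfl,
      Nat.factorial_succ (j + 1)] at h
    have hj : ((j + 1).factorial : ℚ) ≠ 0 := by positivity
    push_cast at h
    have e : gval x / (j + 2) = (j + 1).factorial *
        (gval x * (1 / ((j + 1 + 1) * (j + 1).factorial))) := by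
      field_simp; ring
    rw [e, ← h]; ring
  refine strictAnti_nat_of_succ_lt fun j => ?_
  rw [key, key, Nat.factorial_succ (j + 1), mul_comm (j + 1 + 1), Nat.cast_mul, mul_assoc]
  have hj : (0 : ℚ) < (j + 1).factorial := by positivity
  refine mul_lt_mul_of_pos_left ?_ hj
  have h1 := gval_append_c_succ_le x (j + 2)
  have h1' := gval_pos (x ++ cpow (j + 2 + 1))
  have h2 : ((j : ℚ) + 2) * lastC (fun u => gval (u ++ CD.d :: cpow (j + 1 + 1))) x ≤
      lastC (fun u => gval (u ++ CD.d :: cpow (j + 1))) x := by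
    rw [← lastC_mul_left]
    refine lastC_mono fun u _ => ?_
    have h3 := gval_append_d_c_succ_le u (j + 1)
    have h4 := gval_nonneg (u ++ CD.d :: cpow (j + 1 + 1))
    push_cast at h3
    linarith
  push_cast at h1 ⊢
  rw [show j + 1 + 2 = j + 2 + 1 by ring]
  linarith

lemma gval_c_d_c_lt {k q : ℕ} (hkq : k < q) :
    (1 / ((q + 1).factorial * (k + 2).factorial) - 1 / ((k + 1).factorial * (q + 2).factorial) : ℚ) =
      ((q : ℚ) + (k + 1 : ℕ) + 3) * (gval (cpow q ++ CD.d :: cpow (k + 1)) -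
        gval (cpow k ++ CD.d :: cpow (q + 1))) ∧
      gval (cpow k ++ CD.d :: cpow (q + 1)) < gval (cpow q ++ CD.d :: cpow (k + 1)) := by
  have e : (1 / ((q + 1).factorial * (k + 2).factorial) -
      1 / ((k + 1).factorial * (q + 2).factorial) : ℚ) =
      ((q : ℚ) + (k + 1 : ℕ) + 3) * (gval (cpow q ++ CD.d :: cpow (k + 1)) -
        gval (cpow k ++ CD.d :: cpow (q + 1))) := by
    rw [gval_c_d_c, gval_c_d_c, show q + (k + 1) + 2 = k + (q + 1) + 2 by ring]
    have h : (q : ℚ) + (k + 1 : ℕ) + 3 ≠ 0 := by positivity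
    rw [show (k : ℚ) + (q + 1 : ℕ) + 3 = q + (k + 1 : ℕ) + 3 by push_cast; ring, ← sub_div,
      mul_div_cancel₀ _ h]
    ring
  refine ⟨e, ?_⟩
  have hpos : (0 : ℚ) < 1 / ((q + 1).factorial * (k + 2).factorial) -
      1 / ((k + 1).factorial * (q + 2).factorial) := by
    rw [sub_pos, Nat.factorial_succ (q + 1), Nat.factorial_succ (k + 1)]
    push_cast
    have h1 : (k : ℚ) < q := by exact_mod_cast hkq
    have h2 : (0 : ℚ) < (q + 1).factorial * (k + 1).factorial := by positivity
    refine one_div_lt_one_div_of_lt (by positivity) ?_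
    nlinarith
  rw [e] at hpos
  exact sub_pos.1 (pos_of_mul_pos_right hpos (by positivity))

/-- Moving one unit towards balance, with the larger entry placed first. -/
lemma gval_two_lt (x : List CD) {k q : ℕ} (hkq : k < q) :
    gval (x ++ CD.d :: (cpow k ++ CD.d :: cpow (q + 1))) <
      gval (x ++ CD.d :: (cpow q ++ CD.d :: cpow (k + 1))) := by
  induction h : x.length using Nat.strong_induction_on generalizing x with
  | _ l ih =>
  subst h
  have h1 := gval_rec_left_two x k (q + 1)
  have h2 := gval_rec_left_two x q (k + 1)
  rw [show wdeg x + q + (k + 1) + 4 = wdeg x + k + (q + 1) + 4 by ring] at h2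
  set N : ℚ := ((wdeg x + k + (q + 1) + 4 : ℕ) : ℚ) with hN
  have hN0 : 0 < N * (N + 1) := by positivity
  have hF := firstC_mono (v := x)
    (K := fun x' => gval (x' ++ CD.d :: (cpow k ++ CD.d :: cpow (q + 1))))
    (K' := fun x' => gval (x' ++ CD.d :: (cpow q ++ CD.d :: cpow (k + 1))))
    fun w e => (ih _ (by simp [e]) w rfl).le
  have hS : splitD (fun u w => ((wdeg w : ℚ) + k + (q + 1 : ℕ) + 5) *
        (gval u * gval (w ++ CD.d :: (cpow k ++ CD.d :: cpow (q + 1))))) x ≤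
      splitD (fun u w => ((wdeg w : ℚ) + q + (k + 1 : ℕ) + 5) *
        (gval u * gval (w ++ CD.d :: (cpow q ++ CD.d :: cpow (k + 1))))) x := by
    refine splitD_mono fun u w e => ?_
    have := (ih w.length (by simp [e]; omega) w rfl).le
    have hu := gval_nonneg u
    rw [show (wdeg w : ℚ) + q + (k + 1 : ℕ) + 5 = wdeg w + k + (q + 1 : ℕ) + 5 by
      push_cast; ring]
    gcongr
  -- The difference of the two sides is the defect at `k` minus the defect at `q`, divided by (q +
  -- 1)! (k + 1)!.
  have hmid : ((k : ℚ) + (q + 1 : ℕ) + 3) * (gval x * gval (cpow k ++ CD.d :: cpow (q + 1))) +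
      (((q + 1 : ℕ) : ℚ) + 1) * (gval (x ++ CD.d :: cpow k) * gval (cpow (q + 1))) <
      ((q : ℚ) + (k + 1 : ℕ) + 3) * (gval x * gval (cpow q ++ CD.d :: cpow (k + 1))) +
      (((k + 1 : ℕ) : ℚ) + 1) * (gval (x ++ CD.d :: cpow q) * gval (cpow (k + 1))) := by
    have hw := strictAnti_gval_defect x hkq
    have e := (gval_c_d_c_lt hkq).1
    have ek : (((k + 1 : ℕ) : ℚ) + 1) * (gval (x ++ CD.d :: cpow q) * gval (cpow (k + 1))) =
        (q + 1).factorial * gval (x ++ CD.d :: cpow q) *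
          (1 / ((q + 1).factorial * (k + 1).factorial)) := by
      rw [gval_replicate_c, Nat.factorial_succ (k + 1)]
      push_cast
      have : ((k + 1).factorial : ℚ) ≠ 0 := by positivity
      have : ((q + 1).factorial : ℚ) ≠ 0 := by positivity
      field_simp
    have eq : (((q + 1 : ℕ) : ℚ) + 1) * (gval (x ++ CD.d :: cpow k) * gval (cpow (q + 1))) =
        (k + 1).factorial * gval (x ++ CD.d :: cpow k) *
          (1 / ((q + 1).factorial * (k + 1).factorial)) := by
      rw [gval_replicate_c, Nat.factorial_succ (q + 1)]
      push_cast
      have : ((k + 1).factorial : ℚ) ≠ 0 := by positivity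
      have : ((q + 1).factorial : ℚ) ≠ 0 := by positivity
      field_simp
    have ew : gval x * (1 / ((q + 1).factorial * (k + 2).factorial) -
        1 / ((k + 1).factorial * (q + 2).factorial)) =
        (gval x / (k + 2) - gval x / (q + 2)) *
          (1 / ((q + 1).factorial * (k + 1).factorial)) := by
      rw [Nat.factorial_succ (k + 1), Nat.factorial_succ (q + 1)]
      push_cast
      have : ((k + 1).factorial : ℚ) ≠ 0 := by positivity
      have : ((q + 1).factorial : ℚ) ≠ 0 := by positivity
      rw [show (k : ℚ) + 1 + 1 = k + 2 by ring, show (q : ℚ) + 1 + 1 = q + 2 by ring]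
      field_simp
    rw [e] at ew
    rw [ek, eq]
    have hpos : (0 : ℚ) < 1 / ((q + 1).factorial * (k + 1).factorial) := by positivity
    have := mul_lt_mul_of_pos_right hw hpos
    push_cast at ew ⊢
    linear_combination this - ew
  have hNF := mul_le_mul_of_nonneg_left hF (show 0 ≤ N by positivity)
  refine lt_of_mul_lt_mul_left ?_ hN0.le
  linear_combination h1 - h2 + hNF + hS + hmid

/-- Each step moves one unit towards balance and puts the larger entry first; `hswap` restores the
order before the next step. -/
lemma lt_of_strictlyBetterBalanced_aux (f : ℕ → ℕ → ℚ) (hswap : ∀ m n, m ≤ n → f n m ≤ f m n)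
    (hstep : ∀ k q, k < q → f k (q + 1) < f q (k + 1)) (d : ℕ) :
    ∀ a b, a + d + 1 ≤ b → f a (b + d + 1) < f b (a + d + 1) := by
  induction d with
  | zero => exact fun a b h => hstep a b h
  | succ d ih =>
    intro a b h
    calc f a (b + (d + 1) + 1) < f (b + (d + 1)) (a + 1) := hstep _ _ (by omega)
      _ ≤ f (a + 1) (b + (d + 1)) := hswap _ _ (by omega)
      _ = f (a + 1) (b + d + 1) := by rw [add_assoc b]
      _ < f b (a + 1 + d + 1) := ih (a + 1) b (by omega)
      _ = f b (a + (d + 1) + 1) := by congr 1; ring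

/-- It suffices to compare the favourable order of the worse balanced pair, smaller entry first,
with the unfavourable order of the better balanced one. -/
lemma lt_of_strictlyBetterBalanced (f : ℕ → ℕ → ℚ) (hswap : ∀ m n, m ≤ n → f n m ≤ f m n)
    (hstep : ∀ k q, k < q → f k (q + 1) < f q (k + 1)) {m₁ n₁ m₂ n₂ : ℕ}
    (h : StrictlyBetterBalanced m₁ n₁ m₂ n₂) : f m₂ n₂ < f m₁ n₁ := by
  have h1 : f (max m₁ n₁) (min m₁ n₁) ≤ f m₁ n₁ := by
    rcases le_total m₁ n₁ with h | h
    · rw [max_eq_right h, min_eq_left h]; exact hswap _ _ h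
    · rw [max_eq_left h, min_eq_right h]
  have h2 : f m₂ n₂ ≤ f (min m₂ n₂) (max m₂ n₂) := by
    rcases le_total m₂ n₂ with h | h
    · rw [max_eq_right h, min_eq_left h]
    · rw [max_eq_left h, min_eq_right h]; exact hswap _ _ h
  refine h2.trans_lt (lt_of_lt_of_le ?_ h1)
  have hs := h.1
  have hb := h.min_lt
  obtain ⟨d, hd⟩ : ∃ d, min m₁ n₁ = min m₂ n₂ + d + 1 := ⟨min m₁ n₁ - min m₂ n₂ - 1, by omega⟩
  have := lt_of_strictlyBetterBalanced_aux f hswap hstep d (min m₂ n₂) (max m₁ n₁) (by omega)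
  rwa [← hd, show max m₁ n₁ + d + 1 = max m₂ n₂ by omega] at this

/-! ### A pair at the beginning or in the interior of the list -/

/-- The bounds make (j + 2)! γ j strictly increasing and (j + 1)! δ j weakly decreasing. Balancing
raises the first index and lowers the second, and the factorials to be divided out favour the
balanced pair by log-convexity. -/
lemma mul_lt_mul_of_strictlyBetterBalanced_aux {γ δ : ℕ → ℚ} (hγ : ∀ j, 0 < γ j)
    (hδ : ∀ j, 0 < δ j) (hγ' : ∀ j, γ j < (j + 3) * γ (j + 1))
    (hδ' : ∀ j, (j + 2) * δ (j + 1) ≤ δ j) {m₁ n₁ m₂ n₂ : ℕ}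
    (h : StrictlyBetterBalanced m₁ n₁ m₂ n₂) (hle : m₂ ≤ n₂) :
    γ m₂ * δ n₂ < γ m₁ * δ n₁ := by
  have hs := h.1
  have hb := h.min_lt
  have hmono : StrictMono fun j : ℕ => ((j + 2).factorial : ℚ) * γ j := by
    refine strictMono_nat_of_lt_succ fun j => ?_
    rw [show j + 1 + 2 = (j + 2) + 1 by ring, Nat.factorial_succ (j + 2)]
    push_cast
    have : (0 : ℚ) < (j + 2).factorial := by positivity
    have := mul_lt_mul_of_pos_left (hγ' j) this
    linarith
  have hanti : Antitone fun j : ℕ => ((j + 1).factorial : ℚ) * δ j := by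
    refine antitone_nat_of_succ_le fun j => ?_
    rw [Nat.factorial_succ (j + 1)]
    push_cast
    have : (0 : ℚ) < (j + 1).factorial := by positivity
    have := mul_le_mul_of_nonneg_left (hδ' j) this.le
    linarith
  have h1 : ((m₂ + 2).factorial : ℚ) * γ m₂ < (m₁ + 2).factorial * γ m₁ := hmono (by omega)
  have h2 : ((n₂ + 1).factorial : ℚ) * δ n₂ ≤ (n₁ + 1).factorial * δ n₁ := hanti (by omega)
  have h3 : ((m₁ + 2).factorial * (n₁ + 1).factorial : ℚ) ≤
      (m₂ + 2).factorial * (n₂ + 1).factorial := by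
    exact_mod_cast factorial_mul_factorial_le (by omega) (by omega) (by omega)
  have hpos : (0 : ℚ) < (m₂ + 2).factorial * (n₂ + 1).factorial := by positivity
  refine lt_of_mul_lt_mul_left ?_ hpos.le
  have g1 := hγ m₁
  have g2 := hγ m₂
  have d1 := hδ n₁
  have d2 := hδ n₂
  calc _ = ((m₂ + 2).factorial * γ m₂) * ((n₂ + 1).factorial * δ n₂) := by ring
    _ < ((m₁ + 2).factorial * γ m₁) * ((n₁ + 1).factorial * δ n₁) :=
      mul_lt_mul h1 h2 (by positivity) (by positivity)
    _ = ((m₁ + 2).factorial * (n₁ + 1).factorial) * (γ m₁ * δ n₁) := by ring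
    _ ≤ _ := by gcongr

lemma mul_lt_mul_of_strictlyBetterBalanced {γ δ : ℕ → ℚ} (hγ : ∀ j, 0 < γ j)
    (hδ : ∀ j, 0 < δ j) (hγ₁ : ∀ j, (j + 2) * γ (j + 1) ≤ γ j)
    (hγ₂ : ∀ j, γ j < (j + 3) * γ (j + 1)) (hδ₁ : ∀ j, (j + 2) * δ (j + 1) ≤ δ j)
    (hδ₂ : ∀ j, δ j < (j + 3) * δ (j + 1)) {m₁ n₁ m₂ n₂ : ℕ}
    (h : StrictlyBetterBalanced m₁ n₁ m₂ n₂) : γ m₂ * δ n₂ < γ m₁ * δ n₁ := by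
  rcases le_total m₂ n₂ with hle | hle
  · exact mul_lt_mul_of_strictlyBetterBalanced_aux hγ hδ hγ₂ hδ₁ h hle
  · rw [mul_comm (γ m₂), mul_comm (γ m₁)]
    exact mul_lt_mul_of_strictlyBetterBalanced_aux hδ hγ hδ₂ hγ₁ h.swap hle

lemma gval_balanced_nil_nil {m₁ n₁ m₂ n₂ : ℕ} (h : StrictlyBetterBalanced m₁ n₁ m₂ n₂) :
    gval (cpow m₂ ++ CD.d :: cpow n₂) < gval (cpow m₁ ++ CD.d :: cpow n₁) :=
  lt_of_strictlyBetterBalanced (fun m n => gval (cpow m ++ CD.d :: cpow n))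
    (fun m n _ => (gval_c_d_c_comm n m).le) (fun _ _ h => (gval_c_d_c_lt h).2) h

lemma gval_balanced_cons_nil (x : List CD) {m₁ n₁ m₂ n₂ : ℕ}
    (h : StrictlyBetterBalanced m₁ n₁ m₂ n₂) :
    gval (x ++ CD.d :: (cpow m₂ ++ CD.d :: cpow n₂)) <
      gval (x ++ CD.d :: (cpow m₁ ++ CD.d :: cpow n₁)) :=
  lt_of_strictlyBetterBalanced (fun m n => gval (x ++ CD.d :: (cpow m ++ CD.d :: cpow n)))
    (fun _ _ h => gval_two_swap_le x h) (fun _ _ h => gval_two_lt x h) h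

lemma gval_c_d_append (n : ℕ) (y : List CD) :
    gval (cpow n ++ CD.d :: y) = gval (y.reverse ++ CD.d :: cpow n) := by
  rw [← gval_reverse]; simp

lemma gval_balanced_nil_cons (y : List CD) {m₁ n₁ m₂ n₂ : ℕ}
    (h : StrictlyBetterBalanced m₁ n₁ m₂ n₂) :
    gval (cpow m₂ ++ CD.d :: (cpow n₂ ++ CD.d :: y)) <
      gval (cpow m₁ ++ CD.d :: (cpow n₁ ++ CD.d :: y)) := by
  have e : ∀ m n, gval (cpow m ++ CD.d :: (cpow n ++ CD.d :: y)) =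
      gval (y.reverse ++ CD.d :: (cpow n ++ CD.d :: cpow m)) := by
    intro m n
    rw [← gval_reverse]; simp
  rw [e, e]
  exact gval_balanced_cons_nil _ h.swap

/-- The symmetric recursion is used here because its coefficients depend on `m` and `n` only through
their sum; in the one-sided one, the weight of the split between the two blocks depends on `n`
separately. -/
lemma gval_rec_two (x y : List CD) (m n : ℕ) :
    2 * (((wdeg x + (m + n) + wdeg y + 6 : ℕ) : ℚ) + 1) *
        gval (x ++ CD.d :: (cpow m ++ CD.d :: (cpow n ++ CD.d :: y))) =
      firstC (fun x' => gval (x' ++ CD.d :: (cpow m ++ CD.d :: (cpow n ++ CD.d :: y)))) x +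
      lastC (fun y' => gval (x ++ CD.d :: (cpow m ++ CD.d :: (cpow n ++ CD.d :: y')))) y +
      splitD (fun u w =>
        gval u * gval (w ++ CD.d :: (cpow m ++ CD.d :: (cpow n ++ CD.d :: y)))) x +
      splitD (fun u w =>
        gval w * gval (x ++ CD.d :: (cpow m ++ CD.d :: (cpow n ++ CD.d :: u)))) y +
      gval x * gval (cpow m ++ CD.d :: (cpow n ++ CD.d :: y)) +
      gval y * gval (x ++ CD.d :: (cpow m ++ CD.d :: cpow n)) +
      gval (x ++ CD.d :: cpow m) * gval (cpow n ++ CD.d :: y) := by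
  have h := gval_rec (x ++ CD.d :: (cpow m ++ CD.d :: (cpow n ++ CD.d :: y))) (by simp)
  have hd : wdeg (x ++ CD.d :: (cpow m ++ CD.d :: (cpow n ++ CD.d :: y))) =
      wdeg x + (m + n) + wdeg y + 6 := by simp; omega
  rw [hd] at h
  rw [h, firstC_append_d, lastC_append_d, lastC_append_d, lastC_append_d]
  simp only [splitD_append, splitD_d, splitD_replicate_c, List.append_nil]
  simp only [mul_comm (gval y), mul_comm (gval _) (gval (x ++ _))]
  ring

lemma gval_balanced_cons_cons (x y : List CD) {m₁ n₁ m₂ n₂ : ℕ}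
    (h : StrictlyBetterBalanced m₁ n₁ m₂ n₂) :
    gval (x ++ CD.d :: (cpow m₂ ++ CD.d :: (cpow n₂ ++ CD.d :: y))) <
      gval (x ++ CD.d :: (cpow m₁ ++ CD.d :: (cpow n₁ ++ CD.d :: y))) := by
  induction hl : x.length + y.length using Nat.strong_induction_on generalizing x y with
  | _ l ih =>
  subst hl
  have h1 := gval_rec_two x y m₁ n₁
  have h2 := gval_rec_two x y m₂ n₂
  rw [← h.1] at h2
  have hF := firstC_mono (v := x)
    (K := fun x' => gval (x' ++ CD.d :: (cpow m₂ ++ CD.d :: (cpow n₂ ++ CD.d :: y))))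
    (K' := fun x' => gval (x' ++ CD.d :: (cpow m₁ ++ CD.d :: (cpow n₁ ++ CD.d :: y))))
    fun w e => (ih _ (by simp [e]) w y rfl).le
  have hL := lastC_mono (v := y)
    (K := fun y' => gval (x ++ CD.d :: (cpow m₂ ++ CD.d :: (cpow n₂ ++ CD.d :: y'))))
    (K' := fun y' => gval (x ++ CD.d :: (cpow m₁ ++ CD.d :: (cpow n₁ ++ CD.d :: y'))))
    fun w e => (ih _ (by simp [e]) x w rfl).le
  have hSx : splitD (fun u w =>
        gval u * gval (w ++ CD.d :: (cpow m₂ ++ CD.d :: (cpow n₂ ++ CD.d :: y)))) x ≤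
      splitD (fun u w =>
        gval u * gval (w ++ CD.d :: (cpow m₁ ++ CD.d :: (cpow n₁ ++ CD.d :: y)))) x :=
    splitD_mono fun u w e => mul_le_mul_of_nonneg_left
      (ih _ (by simp [e]; omega) w y rfl).le (gval_nonneg u)
  have hSy : splitD (fun u w =>
        gval w * gval (x ++ CD.d :: (cpow m₂ ++ CD.d :: (cpow n₂ ++ CD.d :: u)))) y ≤
      splitD (fun u w =>
        gval w * gval (x ++ CD.d :: (cpow m₁ ++ CD.d :: (cpow n₁ ++ CD.d :: u)))) y :=
    splitD_mono fun u w e => mul_le_mul_of_nonneg_left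
      (ih _ (by simp [e]) x u rfl).le (gval_nonneg w)
  have hx := mul_le_mul_of_nonneg_left (gval_balanced_nil_cons y h).le (gval_nonneg x)
  have hy := mul_le_mul_of_nonneg_left (gval_balanced_cons_nil x h).le (gval_nonneg y)
  -- The split between the two blocks supplies the strictness; the other terms are needed only as
  -- weak inequalities.
  have hmid := mul_lt_mul_of_strictlyBetterBalanced
    (γ := fun j => gval (x ++ CD.d :: cpow j)) (δ := fun j => gval (cpow j ++ CD.d :: y))
    (fun j => gval_pos _) (fun j => gval_pos _) (gval_append_d_c_succ_le x)
    (lt_gval_append_d_c_succ x)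
    (fun j => by rw [gval_c_d_append, gval_c_d_append]; exact gval_append_d_c_succ_le _ j)
    (fun j => by rw [gval_c_d_append, gval_c_d_append]; exact lt_gval_append_d_c_succ _ j) h
  have hN : 0 ≤ 2 * (((wdeg x + (m₁ + n₁) + wdeg y + 6 : ℕ) : ℚ) + 1) := by positivity
  refine lt_of_mul_lt_mul_left ?_ hN
  linear_combination h2 - h1 + hF + hL + hSx + hSy + hx + hy + hmid

/-! ### From words back to lists -/

/-- The word `d c^{m₁} d c^{m₂} ⋯ d c^{m_k}`. -/
def suffixWord (L : List ℕ) : List CD := L.flatMap fun m => CD.d :: cpow m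

@[simp] lemma suffixWord_nil : suffixWord [] = [] := rfl
@[simp] lemma suffixWord_cons (m : ℕ) (L : List ℕ) :
    suffixWord (m :: L) = CD.d :: (cpow m ++ suffixWord L) := by simp [suffixWord]
@[simp] lemma suffixWord_append (L L' : List ℕ) :
    suffixWord (L ++ L') = suffixWord L ++ suffixWord L' := by simp [suffixWord]

lemma toList_of_c_pow (m : ℕ) : (FreeMonoid.of CD.c ^ m).toList = cpow m := by
  induction m with
  | zero => rfl
  | succ m ih => rw [pow_succ', FreeMonoid.toList_of_mul, ih]; rfl

lemma toList_listMonomial (m : ℕ) (L : List ℕ) :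
    (listMonomial m L).toList = cpow m ++ suffixWord L := by
  rw [listMonomial, FreeMonoid.toList_mul, toList_of_c_pow]
  congr 1
  induction L with
  | nil => rfl
  | cons a L ih =>
    rw [List.map_cons, List.prod_cons, FreeMonoid.toList_mul, ih, FreeMonoid.toList_of_mul,
      toList_of_c_pow, suffixWord_cons]
    rfl

lemma beta_cons (m : ℕ) (L : List ℕ) : beta (m :: L) =
    (wdeg (cpow m ++ suffixWord L) + 1).factorial * gval (cpow m ++ suffixWord L) := by
  rw [beta, betaMonomial_eq, ← wdeg_toList, toList_listMonomial]

lemma beta_le_of_gval_le {m n : ℕ} {L K : List ℕ}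
    (hd : wdeg (cpow m ++ suffixWord L) = wdeg (cpow n ++ suffixWord K))
    (h : gval (cpow m ++ suffixWord L) ≤ gval (cpow n ++ suffixWord K)) :
    beta (m :: L) ≤ beta (n :: K) := by
  rw [beta_cons, beta_cons, hd]; gcongr

lemma beta_lt_of_gval_lt {m n : ℕ} {L K : List ℕ}
    (hd : wdeg (cpow m ++ suffixWord L) = wdeg (cpow n ++ suffixWord K))
    (h : gval (cpow m ++ suffixWord L) < gval (cpow n ++ suffixWord K)) :
    beta (m :: L) < beta (n :: K) := by
  rw [beta_cons, beta_cons, hd]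
  exact mul_lt_mul_of_pos_left h (by positivity)

lemma beta_pair_comm (m n : ℕ) : beta [m, n] = beta [n, m] := by
  rw [beta_cons, beta_cons]
  simp only [suffixWord_cons, suffixWord_nil, List.append_nil]
  rw [gval_c_d_c_comm]
  congr 3
  simp; omega

lemma beta_swap_le (M : List ℕ) {m n : ℕ} (h : m ≤ n) :
    beta (M ++ [n, m]) ≤ beta (M ++ [m, n]) := by
  rcases M with _ | ⟨a, M⟩
  · exact (beta_pair_comm n m).le
  · refine beta_le_of_gval_le (by simp; omega) ?_
    simpa using gval_two_swap_le (cpow a ++ suffixWord M) h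

lemma beta_lt_of_strictlyBetterBalanced (M N : List ℕ) {m₁ n₁ m₂ n₂ : ℕ}
    (h : StrictlyBetterBalanced m₁ n₁ m₂ n₂) :
    beta (M ++ [m₂, n₂] ++ N) < beta (M ++ [m₁, n₁] ++ N) := by
  have hs := h.1
  rcases M with _ | ⟨a, M⟩ <;> rcases N with _ | ⟨b, N⟩ <;>
    refine beta_lt_of_gval_lt (by simp; omega) ?_
  · simpa using gval_balanced_nil_nil h
  · simpa using gval_balanced_nil_cons (cpow b ++ suffixWord N) h
  · simpa using gval_balanced_cons_nil (cpow a ++ suffixWord M) h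
  · simpa using gval_balanced_cons_cons (cpow a ++ suffixWord M) (cpow b ++ suffixWord N) h

end

end CDIndex


theorem theoremt :
    (∀ (M : List ℕ) (m n : ℕ), m < n →
      CDIndex.beta (M ++ [m, n]) ≥ CDIndex.beta (M ++ [n, m]) ∧
      (M = [] → CDIndex.beta (M ++ [m, n]) = CDIndex.beta (M ++ [n, m]))) ∧
    (∀ (M N : List ℕ) (m₁ n₁ m₂ n₂ : ℕ), CDIndex.StrictlyBetterBalanced m₁ n₁ m₂ n₂ →
      CDIndex.beta (M ++ [m₁, n₁] ++ N) > CDIndex.beta (M ++ [m₂, n₂] ++ N)) := by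
  refine ⟨fun M m n h => ⟨CDIndex.beta_swap_le M h.le, ?_⟩, fun M N m₁ n₁ m₂ n₂ h =>
    CDIndex.beta_lt_of_strictlyBetterBalanced M N h⟩
  rintro rfl
  exact CDIndex.beta_pair_comm m n
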